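/- **Setting.** Fix reals $\alpha>1$, $\beta>0$, $0<r_0<R<p$, $P>0$. For every number of users $K$ let there be $B=B(K)\ge 1$ transmitters at deterministic points $a_1,\dots,a_B\in\mathbb R^2$ with $\|a_i\|\le p-R$, and $N=N(K)\ge 1$ resource blocks ($p$ is fixed: a dense network; the placement may depend on $K$). The $K$ user positions $z_k$ are i.i.d. uniform on the disc of radius $p$ around the origin; the fading factors $\nu_{i,k,n}$ are i.i.d. $\mathcal{CN}(0,1)$ and independent of the positions (Rayleigh fading). Let $R_{i,k}=\max\{r_0,\|z_k-a_i\|\}$ and $\gamma_{i,k,n}=|\beta R_{i,k}^{-\alpha}\nu_{i,k,n}|^2$. Let $\mathcal P$ be the set of $(p_{i,n})$ with $p_{i,n}\ge0$ and $\sum_n p_{i,n}\le P$ for all $i$, and let $$\mathcal C^*_{LB}=\max_{(p_{i,n})\in\mathcal P}\mathbb E\Big\{\max_{u_{i,n}\in\{1,\dots,K\}}\sum_{i=1}^B\sum_{n=1}^N\log\Big(1+\frac{\gamma_{i,u_{i,n},n}\,p_{i,n}}{1+\sum_{j\ne i}\gamma_{j,u_{i,n},n}\,p_{j,n}}\Big)\Big\}.$$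 For $c,t>0$ let $\mathsf{OP}(c,t)$ be the maximum of $\sum_{i,n}\log(1+p_{i,n}x_{i,n})$ over $(p_{i,n})\in\mathcal P$ and $x_{i,n}\ge0$ subject to $$\frac{r_0^2\,t}{p^2}=e^{x_{i,n}/(\beta^2r_0^{-2\alpha})}\prod_{j\ne i}\Big(1+\frac{p_{j,n}x_{i,n}}{c^{2\alpha}r_0^{-2\alpha}}\Big)\quad\text{for all }i,n,$$ and let $\bar l(2p,K)$ be the solution $l\ge0$ of $\frac{r_0^2K}{p^2}=e^{l/(\beta^2r_0^{-2\alpha})}\big(1+\frac{lP}{(2p)^{2\alpha}r_0^{-2\alpha}}\big)^{B-1}$. Let $u$ be the Euler–Mascheroni constant. **Claim.** For all sufficiently large $K$ the expectations above exist, the maxima defining $\mathcal C^*_{LB}$, $\mathsf{OP}(r_0,K)$, $\mathsf{OP}(2p,K)$ and $\mathsf{OP}(r_0,K/\log\log K)$ are attained, $\bar l(2p,K)$ exists and is unique, and: 1. Whatever the growth of $B$ and $N$, for all large $K$ $$\Big(1-\frac1{\log K}\Big)\mathsf{OP}\Big(r_0,\frac K{\log\log K}\Big)\le\mathcal C^*_{LB},\qquad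 0.63\,\mathsf{OP}(r_0,K)\le\mathcal C^*_{LB},\qquad 0.63\le\frac{\mathcal C^*_{LB}}{\mathsf{OP}(r_0,K)}.$$ 2. If for some $\varepsilon>0$ we have $B\log\log K\le(1-\varepsilon)\log K$ for all large $K$ (for example, if $B$ is bounded), then $\bar l(2p,K)=\Theta(\log K)$ and $$\frac{\mathcal C^*_{LB}}{\mathsf{OP}(r_0,K)}\le\Big(\frac{2p}{r_0}\Big)^{2\alpha}+O\Big(\frac1{\log K}\Big).$$ If in addition $N=o(\log K)$ (for example, if $N$ is bounded), then for all large $K$ $$\mathcal C^*_{LB}\le\Big(1+\frac{\beta^2r_0^{-2\alpha}u}{\bar l(2p,K)}\Big)\mathsf{OP}(2p,K)\quad\text{and}\quad\mathcal C^*_{LB}\le\Big(\frac{2p}{r_0}\Big)^{2\alpha}\Big(1+\frac{\beta^2r_0^{-2\alpha}u}{\bar l(2p,K)}\Big)\mathsf{OP}(r_0,K).$$ -/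

import Mathlib

open MeasureTheory ProbabilityTheory Filter Asymptotics

namespace DenseNet

noncomputable section

/-- The Euclidean plane, where transmitters and users are located. -/
abbrev Plane : Type := EuclideanSpace ℝ (Fin 2)

/-- The fixed physical parameters of a dense network: path-loss exponent `α`, path-loss
constant `β`, truncation radius `r₀`, margin `R` (transmitters lie in the disc of radius `p - R`),
network radius `p`, and the sum-power constraint `Pcon` of each transmitter. -/
structure Params where
  α : ℝ
  β : ℝ
  r₀ : ℝ
  R : ℝ
  p : ℝ
  Pcon : ℝ
  one_lt_α : 1 < α
  β_pos : 0 < β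
  r₀_pos : 0 < r₀
  r₀_lt_R : r₀ < R
  R_lt_p : R < p
  Pcon_pos : 0 < Pcon

/-- The constant `β² r₀^{-2α}`. -/
def Params.σ (c : Params) : ℝ := c.β ^ 2 * c.r₀ ^ (-2 * c.α)

/-- The circularly symmetric complex normal law `CN(0,1)`: real and imaginary parts are
independent centred Gaussians with variance `1/2` each. -/
def complexNormal : Measure ℂ :=
  ((gaussianReal 0 (1 / 2)).prod (gaussianReal 0 (1 / 2))).map
    (fun z : ℝ × ℝ => (z.1 : ℂ) + (z.2 : ℂ) * Complex.I)

/-- The uniform law on the disc of radius `r` centred at the origin. -/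
def uniformDisc (r : ℝ) : Measure Plane :=
  ProbabilityTheory.cond volume (Metric.closedBall (0 : Plane) r)

/-- A realization of the randomness: the positions of the `K` users and the fading factors
`ν (i, k, n)` (transmitter `i`, user `k`, resource block `n`). -/
abbrev Sample (B K N : ℕ) : Type := (Fin K → Plane) × (Fin B × Fin K × Fin N → ℂ)

/-- The law of the randomness under Rayleigh fading: the user positions are i.i.d. uniform on the
disc of radius `p`, the fading factors are i.i.d. `CN(0,1)`, and both families are independent. -/
def sampleLaw (c : Params) (B K N : ℕ) : Measure (Sample B K N) :=
  (Measure.pi fun _ : Fin K => uniformDisc c.p).prod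
    (Measure.pi fun _ : Fin B × Fin K × Fin N => complexNormal)

/-- The truncated distance `R_{i,k}`. -/
def truncDist (c : Params) (a x : Plane) : ℝ := max c.r₀ (dist x a)

/-- The channel SNR `γ_{i,k,n} = |β R_{i,k}^{-α} ν_{i,k,n}|²`. -/
def snr (c : Params) {B K N : ℕ} (tx : Fin B → Plane) (ω : Sample B K N)
    (i : Fin B) (k : Fin K) (n : Fin N) : ℝ :=
  ‖((c.β * truncDist c (tx i) (ω.1 k) ^ (-c.α) : ℝ) : ℂ) * ω.2 (i, k, n)‖ ^ 2

/-- The feasible power allocations: nonnegative powers, each transmitter spending at most `Pcon`. -/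
def powers (c : Params) (B N : ℕ) : Set (Fin B → Fin N → ℝ) :=
  {q | (∀ i n, 0 ≤ q i n) ∧ ∀ i, ∑ n, q i n ≤ c.Pcon}

/-- The sum-rate for the SNRs `γ`, the user allocation `u` and the power allocation `q`. -/
def sumRate {B K N : ℕ} (γ : Fin B → Fin K → Fin N → ℝ) (u : Fin B → Fin N → Fin K)
    (q : Fin B → Fin N → ℝ) : ℝ :=
  ∑ i, ∑ n, Real.log
    (1 + γ i (u i n) n * q i n / (1 + ∑ j ∈ Finset.univ.erase i, γ j (u i n) n * q j n))

/-- The sum-rate for the power allocation `q`, maximized over all user allocations. -/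
def bestRate (c : Params) {B K N : ℕ} (tx : Fin B → Plane) (q : Fin B → Fin N → ℝ)
    (ω : Sample B K N) : ℝ :=
  ⨆ u : Fin B → Fin N → Fin K, sumRate (snr c tx ω) u q

/-- The expectation of the sum-rate maximized over all user allocations. -/
def expectedRate (c : Params) {B : ℕ} (N K : ℕ) (tx : Fin B → Plane)
    (q : Fin B → Fin N → ℝ) : ℝ :=
  ∫ ω, bestRate c tx q ω ∂(sampleLaw c B K N)

/-- `C*_LB`: the maximum over power allocations of the expected rate. -/
def CLB (c : Params) {B : ℕ} (N K : ℕ) (tx : Fin B → Plane) : ℝ :=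
  sSup (expectedRate c N K tx '' powers c B N)

/-- The pairs `(q, x)` that are feasible for the problem `OP(d, t)`: `q` is a feasible power
allocation and the `x i n ≥ 0` solve the equality constraints. -/
def opFeasible (c : Params) (B N : ℕ) (d t : ℝ) :
    Set ((Fin B → Fin N → ℝ) × (Fin B → Fin N → ℝ)) :=
  {z | z.1 ∈ powers c B N ∧ ∀ i n, 0 ≤ z.2 i n ∧
    c.r₀ ^ 2 * t / c.p ^ 2 = Real.exp (z.2 i n / c.σ) *
      ∏ j ∈ Finset.univ.erase i,
        (1 + z.1 j n * z.2 i n / (d ^ (2 * c.α) * c.r₀ ^ (-2 * c.α)))}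

/-- The objective of the problem `OP`. -/
def opObjective {B N : ℕ} (z : (Fin B → Fin N → ℝ) × (Fin B → Fin N → ℝ)) : ℝ :=
  ∑ i, ∑ n, Real.log (1 + z.1 i n * z.2 i n)

/-- The value `OP(d, t)` of the deterministic optimization problem. -/
def OP (c : Params) (B N : ℕ) (d t : ℝ) : ℝ :=
  sSup (opObjective '' opFeasible c B N d t)

/-- `l ≥ 0` solves the equation that defines `l̄(η, t)`. -/
def IsLBar (c : Params) (B : ℕ) (η t l : ℝ) : Prop :=
  0 ≤ l ∧ c.r₀ ^ 2 * t / c.p ^ 2 =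
    Real.exp (l / c.σ) * (1 + l * c.Pcon / (η ^ (2 * c.α) * c.r₀ ^ (-2 * c.α))) ^ (B - 1)

/-- `l̄(η, t)`, the solution of the equation above (which is unique when `r₀² t ≥ p²`). -/
def lBar (c : Params) (B : ℕ) (η t : ℝ) : ℝ := sSup {l | IsLBar c B η t l}

end

end DenseNet

namespace DenseNet

/-! The summand of transmitter `i` on block `n` depends on the user allocation only through the user
chosen for that pair, so the inner maximum is taken termwise (`ciSup_sum_sum`) and each term
involves the largest of `K` i.i.d. SINRs. Everything rests on the tail of one SINR. Given the
position of the user, the tail at x is exactly e^{-x/g_i} ∏ (1 + x q_j g_j/g_i)⁻¹, where g denotes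
the gains. Users within r₀ of the transmitter have the maximal gain σ, so the tail is at least ρ /
growth (`ofReal_le_userLaw_sinr_gt`). Gain ratios are at least 1/spread and averaging over the
position costs a factor 1 + σ/x, so the tail is at most ρ(1 + σ/x) / growth with powers divided by
the spread (`userLaw_sinr_gt_le`). The constraint of OP(r₀, t) says that the lower bound equals 1/t;
that of OP(2p, t) says the same of the upper bound without the factor 1 + σ/x.

Lower bounds: some user exceeds the threshold with probability at least 1 - (1 - 1/t)^K ≥ 1 -
e^{-K/t}. Taking t = K gives 1 - 1/e > 0.63, and t = K / log log K gives 1 - 1/log K.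

Upper bounds: the mean of the largest SINR exceeds the threshold x of OP(2p, K) by at most σ(u + δ),
as for a Gumbel variable of scale σ (`integral_tail_max_le`). The tangent of the logarithm at x
turns this into an excess (σ/x)(u + δ) · y/(1+y) per block, with y = qx. Since y/(1+y) ≤ log(1+y)
and x ≥ l̄, this yields the factor 1 + σ(u + δ)/l̄. The growth condition on B makes l̄ of order log
K and δ = O(1/log K), and `OP_two_p_le` passes from OP(2p, K) to OP(r₀, K).

To remove δ altogether, two cases are distinguished. If some y ≥ 1, the gap between log(1+y) and
y/(1+y) on that block pays for δ on all blocks (`mul_saturation_le`). If every y < 1, there is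
enough power left to double all powers, so the point is at least a factor 5/4 from optimal
(`five_fourths_mul_opObjective_le`), more than the whole Gumbel correction. -/

/-! ### Rayleigh fading: the law of the modulus -/

lemma lintegral_complexNormal_comp_norm (f : ℝ → ENNReal) (hf : Measurable f) :
    ∫⁻ w, f ‖w‖ ∂complexNormal =
      ∫⁻ r in Set.Ioi (0 : ℝ), ENNReal.ofReal (2 * r * Real.exp (-r ^ 2)) * f r := by
  have hv : ((1 / 2 : NNReal)) ≠ 0 := by norm_num
  have hm : Measurable fun z : ℝ × ℝ => (z.1 : ℂ) + (z.2 : ℂ) * Complex.I := by fun_prop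
  have hpdf : ∀ x : ℝ, gaussianPDF 0 (1 / 2) x =
      ENNReal.ofReal ((Real.sqrt Real.pi)⁻¹ * Real.exp (-x ^ 2)) := by
    intro x
    have h2 : ((1 / 2 : NNReal) : ℝ) = 1 / 2 := by norm_num
    rw [gaussianPDF, gaussianPDFReal, h2]
    congr 3
    · congr 1; ring
    · ring
  have hnorm : ∀ z : ℝ × ℝ, ‖(z.1 : ℂ) + (z.2 : ℂ) * Complex.I‖ = Real.sqrt (z.1 ^ 2 + z.2 ^ 2) :=
    fun z => Complex.norm_add_mul_I _ _
  rw [complexNormal, lintegral_map (by fun_prop) hm, gaussianReal_of_var_ne_zero _ hv,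
    prod_withDensity (measurable_gaussianPDF _ _) (measurable_gaussianPDF _ _),
    lintegral_withDensity_eq_lintegral_mul _ (by fun_prop) (by fun_prop),
    ← Measure.volume_eq_prod, ← lintegral_comp_polarCoord_symm, polarCoord_target,
    Measure.volume_eq_prod, ← Measure.prod_restrict]
  -- In polar coordinates the joint density π⁻¹ e^{-r²} does not involve the angle, which later
  -- contributes the factor 2π.
  have key : ∀ p : ℝ × ℝ, p ∈ Set.Ioi (0 : ℝ) ×ˢ Set.Ioo (-Real.pi) Real.pi →
      ENNReal.ofReal p.1 • ((fun z : ℝ × ℝ => gaussianPDF 0 (1 / 2) z.1 * gaussianPDF 0 (1 / 2) z.2) *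
        fun z : ℝ × ℝ => f ‖(z.1 : ℂ) + (z.2 : ℂ) * Complex.I‖) (polarCoord.symm p) =
      ENNReal.ofReal (Real.pi⁻¹ * p.1 * Real.exp (-p.1 ^ 2)) * f p.1 := by
    rintro ⟨r, θ⟩ ⟨hr, -⟩
    have hr : 0 < r := hr
    have h1 : (r * Real.cos θ) ^ 2 + (r * Real.sin θ) ^ 2 = r ^ 2 := by
      linear_combination r ^ 2 * Real.cos_sq_add_sin_sq θ
    simp only [polarCoord_symm_apply, Pi.mul_apply, hnorm, hpdf, h1, Real.sqrt_sq hr.le, smul_eq_mul]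
    rw [← ENNReal.ofReal_mul (by positivity), ← mul_assoc, ← ENNReal.ofReal_mul hr.le]
    congr 2
    have h2 : Real.exp (-(r * Real.cos θ) ^ 2) * Real.exp (-(r * Real.sin θ) ^ 2) =
        Real.exp (-r ^ 2) := by
      rw [← Real.exp_add, ← h1]; ring_nf
    have h3 : (Real.sqrt Real.pi)⁻¹ * (Real.sqrt Real.pi)⁻¹ = Real.pi⁻¹ := by
      rw [← mul_inv, Real.mul_self_sqrt Real.pi_pos.le]
    calc _ = r * ((Real.sqrt Real.pi)⁻¹ * (Real.sqrt Real.pi)⁻¹) *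
          (Real.exp (-(r * Real.cos θ) ^ 2) * Real.exp (-(r * Real.sin θ) ^ 2)) := by ring
      _ = _ := by rw [h2, h3]; ring
  rw [Measure.prod_restrict, setLIntegral_congr_fun
    (measurableSet_Ioi.prod measurableSet_Ioo) key, ← Measure.prod_restrict,
    lintegral_prod _ (by fun_prop)]
  simp only [lintegral_const, Measure.restrict_apply_univ, Real.volume_Ioo]
  refine setLIntegral_congr_fun measurableSet_Ioi fun r (hr : 0 < r) => ?_
  rw [mul_right_comm, ← ENNReal.ofReal_mul (by positivity)]
  congr 2
  field_simp
  ring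

lemma integral_two_mul_exp_neg_mul_sq {a b : ℝ} (ha : 0 ≤ a) (hb : 0 < b) :
    ∫⁻ r in Set.Ioi a, ENNReal.ofReal (2 * r * Real.exp (-b * r ^ 2)) =
      ENNReal.ofReal (Real.exp (-b * a ^ 2) / b) := by
  have hd : ∀ x : ℝ, HasDerivAt (fun r => -(Real.exp (-b * r ^ 2) / b))
      (2 * x * Real.exp (-b * x ^ 2)) x := by
    intro x
    have := ((((hasDerivAt_id x).pow 2).const_mul (-b)).exp.div_const b).neg
    refine this.congr_deriv ?_
    simp only [id]; field_simp; simp; ring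
  have hnn : ∀ x ∈ Set.Ioi a, 0 ≤ 2 * x * Real.exp (-b * x ^ 2) := by
    intro x hx
    have : 0 ≤ x := ha.trans (le_of_lt hx)
    positivity
  have ht : Tendsto (fun r => -(Real.exp (-b * r ^ 2) / b)) atTop (nhds (-(0 / b))) := by
    refine ((Real.tendsto_exp_atBot.comp ?_).div_const b).neg
    exact (tendsto_pow_atTop two_ne_zero).const_mul_atTop_of_neg (by linarith)
  rw [← ofReal_integral_eq_lintegral_ofReal
    (integrableOn_Ioi_deriv_of_nonneg' (fun x _ => hd x) hnn ht)
    ((ae_restrict_iff' measurableSet_Ioi).2 (ae_of_all _ hnn)),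
    integral_Ioi_of_hasDerivAt_of_nonneg' (fun x _ => hd x) hnn ht]
  congr 1; ring

lemma complexNormal_norm_sq_gt {t : ℝ} (ht : 0 ≤ t) :
    complexNormal {w | t < ‖w‖ ^ 2} = ENNReal.ofReal (Real.exp (-t)) := by
  have hs : MeasurableSet {r : ℝ | t < r ^ 2} := measurableSet_lt (by fun_prop) (by fun_prop)
  have h1 := lintegral_complexNormal_comp_norm ({r : ℝ | t < r ^ 2}.indicator 1)
    (measurable_one.indicator hs)
  have h2 : (fun w : ℂ => ({r : ℝ | t < r ^ 2}.indicator 1 ‖w‖ : ENNReal)) =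
      {w : ℂ | t < ‖w‖ ^ 2}.indicator 1 := by
    ext w; simp [Set.indicator]
  rw [h2, lintegral_indicator_one (measurableSet_lt (by fun_prop) (by fun_prop))] at h1
  rw [h1]
  have h3 : ∀ r : ℝ, ENNReal.ofReal (2 * r * Real.exp (-r ^ 2)) *
      ({r : ℝ | t < r ^ 2}.indicator 1 r : ENNReal) = {r : ℝ | t < r ^ 2}.indicator
        (fun r => ENNReal.ofReal (2 * r * Real.exp (-1 * r ^ 2))) r := by
    intro r; by_cases h : t < r ^ 2 <;> simp [Set.indicator, h]
  simp_rw [h3]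
  rw [lintegral_indicator hs, Measure.restrict_restrict hs]
  have h4 : {r : ℝ | t < r ^ 2} ∩ Set.Ioi 0 = Set.Ioi (Real.sqrt t) := by
    ext r
    simp only [Set.mem_inter_iff, Set.mem_ofPred_eq, Set.mem_Ioi]
    constructor
    · rintro ⟨h, h'⟩; exact (Real.sqrt_lt' h').2 h
    · intro h
      have h' : 0 < r := (Real.sqrt_nonneg t).trans_lt h
      exact ⟨(Real.sqrt_lt' h').1 h, h'⟩
  rw [h4, integral_two_mul_exp_neg_mul_sq (Real.sqrt_nonneg t) one_pos, Real.sq_sqrt ht]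
  simp

/-- The Laplace transform of an exponential variable. Nonnegative s gives the interference factors,
s = 0 the total mass, and s = -1/2 an exponential moment that makes the second moment finite. -/
lemma lintegral_exp_neg_norm_sq {s : ℝ} (hs : -1 < s) :
    ∫⁻ w, ENNReal.ofReal (Real.exp (-(s * ‖w‖ ^ 2))) ∂complexNormal =
      ENNReal.ofReal (1 + s)⁻¹ := by
  rw [lintegral_complexNormal_comp_norm (fun r => ENNReal.ofReal (Real.exp (-(s * r ^ 2))))
    (by fun_prop)]
  have := integral_two_mul_exp_neg_mul_sq (le_refl 0) (b := 1 + s) (by linarith)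
  simp only [ne_eq, OfNat.ofNat_ne_zero, not_false_eq_true, zero_pow, mul_zero, Real.exp_zero,
    one_div] at this
  rw [← this]
  refine setLIntegral_congr_fun measurableSet_Ioi fun r (hr : 0 < r) => ?_
  rw [← ENNReal.ofReal_mul (by positivity), mul_assoc, ← Real.exp_add]
  ring_nf

instance : IsProbabilityMeasure complexNormal := by
  constructor
  have := lintegral_exp_neg_norm_sq (s := 0) (by norm_num)
  simpa using this

lemma integrable_norm_sq_complexNormal : Integrable (fun w : ℂ => ‖w‖ ^ 2) complexNormal := by
  have h := lintegral_exp_neg_norm_sq (s := -1 / 2) (by norm_num)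
  have hi : Integrable (fun w : ℂ => Real.exp (-(-1 / 2 * ‖w‖ ^ 2))) complexNormal := by
    refine ⟨by fun_prop, ?_⟩
    rw [hasFiniteIntegral_iff_ofReal (ae_of_all _ fun _ => (Real.exp_pos _).le), h]
    exact ENNReal.ofReal_lt_top
  refine (hi.const_mul 2).mono' (by fun_prop) (ae_of_all _ fun w => ?_)
  rw [Real.norm_of_nonneg (by positivity)]
  have := Real.add_one_le_exp (-(-1 / 2 * ‖w‖ ^ 2))
  nlinarith

/-! ### Product measures and the outage probability under interference -/

/-- Resampling coordinate `i` independently does not change the law. This form of Fubini conditions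
on the interference without splitting the index type. -/
lemma lintegral_pi_eq_lintegral_update {ι : Type*} [Fintype ι] [DecidableEq ι] {X : ι → Type*}
    [∀ i, MeasurableSpace (X i)] (μ : ∀ i, Measure (X i)) [∀ i, IsProbabilityMeasure (μ i)]
    (i : ι) (f : (∀ i, X i) → ENNReal) (hf : Measurable f) :
    ∫⁻ x, f x ∂Measure.pi μ =
      ∫⁻ x, ∫⁻ t, f (Function.update x i t) ∂μ i ∂Measure.pi μ := by
  have : Nonempty (∀ i, X i) := by
    by_contra h
    rw [not_nonempty_iff] at h
    have h1 : Measure.pi μ Set.univ = 1 := measure_univ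
    rw [Set.univ_eq_empty_iff.2 h, measure_empty] at h1
    exact zero_ne_one h1
  obtain ⟨x₀⟩ := this
  have hm : Measurable fun x : (∀ i, X i) => ∫⁻ t, f (Function.update x i t) ∂μ i := by
    apply Measurable.lintegral_prod_right'
      (f := fun p : (∀ i, X i) × X i => f (Function.update p.1 i p.2))
    exact hf.comp measurable_update'
  rw [lintegral_eq_lmarginal_univ (f := f) x₀,
    lintegral_eq_lmarginal_univ (f := fun x => ∫⁻ t, f (Function.update x i t) ∂μ i) x₀,
    lmarginal_erase' f hf (Finset.mem_univ i), lmarginal_erase' _ hm (Finset.mem_univ i)]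
  simp [Function.update_idem]

lemma lintegral_pi_prod_erase {ι : Type*} [Fintype ι] [DecidableEq ι] {X : ι → Type*}
    [∀ i, MeasurableSpace (X i)] (μ : ∀ i, Measure (X i)) [∀ i, IsProbabilityMeasure (μ i)]
    (s : Finset ι) (f : ∀ i, X i → ENNReal) (hf : ∀ i, Measurable (f i)) :
    ∫⁻ x, ∏ i ∈ s, f i (x i) ∂Measure.pi μ = ∏ i ∈ s, ∫⁻ t, f i t ∂μ i := by
  have hind : iIndepFun (fun i (x : ∀ i, X i) => f i (x i)) (Measure.pi μ) :=
    iIndepFun_pi fun i => (hf i).aemeasurable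
  have h1 := lintegral_prod_eq_prod_lintegral_of_indepFun s
    (fun i (x : ∀ i, X i) => f i (x i)) hind (fun i => (hf i).comp (measurable_pi_apply i))
  rw [h1]
  refine Finset.prod_congr rfl fun i _ => ?_
  exact (measurePreserving_eval μ i).lintegral_comp (hf i)

/-- Probability that an exponential signal exceeds `x` times noise plus exponential
interference. -/
lemma pi_complexNormal_outage {ι : Type*} [Fintype ι] [DecidableEq ι] (i : ι) (s q : ι → ℝ)
    (hs : ∀ j, 0 < s j) (hq : ∀ j, 0 ≤ q j) {x : ℝ} (hx : 0 ≤ x) :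
    Measure.pi (fun _ : ι => complexNormal)
      {v | x < s i * ‖v i‖ ^ 2 / (1 + ∑ j ∈ Finset.univ.erase i, s j * ‖v j‖ ^ 2 * q j)} =
      ENNReal.ofReal (Real.exp (-(x / s i)) *
        ∏ j ∈ Finset.univ.erase i, (1 + x * q j * s j / s i)⁻¹) := by
  have hm : Measurable fun v : ι → ℂ =>
      s i * ‖v i‖ ^ 2 / (1 + ∑ j ∈ Finset.univ.erase i, s j * ‖v j‖ ^ 2 * q j) := by fun_prop
  have hA : MeasurableSet {v : ι → ℂ | x < s i * ‖v i‖ ^ 2 /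
      (1 + ∑ j ∈ Finset.univ.erase i, s j * ‖v j‖ ^ 2 * q j)} :=
    measurableSet_lt measurable_const hm
  rw [← lintegral_indicator_one hA,
    lintegral_pi_eq_lintegral_update _ i _ (measurable_one.indicator hA)]
  -- Given the interference I, the signal must exceed x(1 + I)/s_i. This has probability e^{-x(1 +
  -- I)/s_i}, which factors over the interferers.
  have inner : ∀ v : ι → ℂ, ∫⁻ t, ({v : ι → ℂ | x < s i * ‖v i‖ ^ 2 /
      (1 + ∑ j ∈ Finset.univ.erase i, s j * ‖v j‖ ^ 2 * q j)}.indicator 1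
        (Function.update v i t) : ENNReal) ∂complexNormal =
      ENNReal.ofReal (Real.exp (-(x / s i))) * ∏ j ∈ Finset.univ.erase i,
        ENNReal.ofReal (Real.exp (-((x * q j * s j / s i) * ‖v j‖ ^ 2))) := by
    intro v
    set I : ℝ := ∑ j ∈ Finset.univ.erase i, s j * ‖v j‖ ^ 2 * q j with hI
    have hI0 : 0 ≤ I := Finset.sum_nonneg fun j _ =>
      mul_nonneg (mul_nonneg (hs j).le (by positivity)) (hq j)
    have h1 : ∀ t : ℂ, ({v : ι → ℂ | x < s i * ‖v i‖ ^ 2 /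
        (1 + ∑ j ∈ Finset.univ.erase i, s j * ‖v j‖ ^ 2 * q j)}.indicator 1
        (Function.update v i t) : ENNReal) =
        {t : ℂ | x * (1 + I) / s i < ‖t‖ ^ 2}.indicator 1 t := by
      intro t
      have h2 : ∑ j ∈ Finset.univ.erase i, s j * ‖Function.update v i t j‖ ^ 2 * q j = I :=
        Finset.sum_congr rfl fun j hj => by rw [Function.update_of_ne (Finset.ne_of_mem_erase hj)]
      have h3 : x < s i * ‖t‖ ^ 2 / (1 + I) ↔ x * (1 + I) / s i < ‖t‖ ^ 2 := by
        rw [lt_div_iff₀ (by linarith), div_lt_iff₀ (hs i), mul_comm (s i)]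
      simp only [Set.indicator, Set.mem_ofPred_eq, h2, Function.update_self, h3,
        Pi.one_apply]
    simp_rw [h1]
    rw [lintegral_indicator_one (measurableSet_lt (by fun_prop) (by fun_prop)),
      complexNormal_norm_sq_gt (div_nonneg (mul_nonneg hx (by linarith)) (hs i).le),
      ← ENNReal.ofReal_prod_of_nonneg (fun _ _ => (Real.exp_pos _).le),
      ← ENNReal.ofReal_mul (Real.exp_pos _).le, ← Real.exp_sum, ← Real.exp_add]
    congr 2
    rw [hI, Finset.sum_neg_distrib, ← neg_add, mul_add, add_div, Finset.mul_sum,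
      Finset.sum_div, mul_one]
    congr 2
    exact Finset.sum_congr rfl fun j _ => by ring
  simp_rw [inner]
  rw [lintegral_const_mul _ (by fun_prop),
    lintegral_pi_prod_erase (fun _ : ι => complexNormal) _
      (fun j t => ENNReal.ofReal (Real.exp (-((x * q j * s j / s i) * ‖t‖ ^ 2))))
      (fun j => by fun_prop),
    ENNReal.ofReal_mul (Real.exp_pos _).le]
  have h0 : ∀ j, 0 ≤ x * q j * s j / s i := fun j =>
    div_nonneg (mul_nonneg (mul_nonneg hx (hq j)) (hs j).le) (hs i).le
  rw [ENNReal.ofReal_prod_of_nonneg (fun j _ => by have := h0 j; positivity)]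
  congr 1
  exact Finset.prod_congr rfl fun j _ => lintegral_exp_neg_norm_sq (by linarith [h0 j])

/-! ### Independence of the users on one resource block -/

/-- For fixed `n` the reindexing (k, i) ↦ (i, k, n) is injective, so the selected factors remain
independent, and currying groups them by user. One block at a time suffices because expectations of
blocks are only added. -/
lemma pi_map_curry_block (B K N : ℕ) (n : Fin N) :
    (Measure.pi fun _ : Fin B × Fin K × Fin N => complexNormal).map
      (fun v (k : Fin K) (i : Fin B) => v (i, k, n)) =
    Measure.pi fun _ : Fin K => Measure.pi fun _ : Fin B => complexNormal := by
  have h1 : (Measure.pi fun _ : Fin B × Fin K × Fin N => complexNormal).map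
      (fun v (p : Fin K × Fin B) => v (p.2, p.1, n)) =
      Measure.pi fun _ : Fin K × Fin B => complexNormal := by
    have hind : iIndepFun (fun (j : Fin B × Fin K × Fin N) (v : Fin B × Fin K × Fin N → ℂ) => v j)
        (Measure.pi fun _ : Fin B × Fin K × Fin N => complexNormal) :=
      iIndepFun_pi (X := fun _ => id) fun _ => aemeasurable_id
    have hg : Function.Injective fun p : Fin K × Fin B => (p.2, p.1, n) := by
      rintro ⟨a, b⟩ ⟨a', b'⟩ h; simp_all
    have h2 := (iIndepFun_iff_map_fun_eq_pi_map
      (fun p => (measurable_pi_apply _).aemeasurable)).1 (hind.precomp hg)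
    have h3 : ∀ p : Fin K × Fin B,
        (Measure.pi fun _ : Fin B × Fin K × Fin N => complexNormal).map
        (((fun (j : Fin B × Fin K × Fin N) (v : Fin B × Fin K × Fin N → ℂ) => v j) ∘
          fun p : Fin K × Fin B => (p.2, p.1, n)) p) = complexNormal := fun p =>
      (measurePreserving_eval (fun _ : Fin B × Fin K × Fin N => complexNormal) (p.2, p.1, n)).map_eq
    exact h2.trans (congrArg Measure.pi (funext h3))
  have h4 := Measure.infinitePi_map_curry (fun (_ : Fin K) (_ : Fin B) => complexNormal)
  simp only [Measure.infinitePi_eq_pi] at h4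
  rw [← h4, ← h1, Measure.map_map (by fun_prop) (by fun_prop)]
  rfl

lemma volume_closedBall_plane (a : Plane) {r : ℝ} :
    volume (Metric.closedBall a r) = ENNReal.ofReal r ^ 2 * ENNReal.ofReal Real.pi := by
  rw [EuclideanSpace.volume_closedBall_fin_two]

lemma isProbabilityMeasure_uniformDisc {r : ℝ} (hr : 0 < r) :
    IsProbabilityMeasure (uniformDisc r) := by
  refine cond_isProbabilityMeasure_of_finite ?_ ?_ <;> rw [volume_closedBall_plane]
  · have := Real.pi_pos
    positivity
  · finiteness

/-- The law of the data of one user on one resource block. -/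
noncomputable def userLaw (c : Params) (B : ℕ) : Measure (Plane × (Fin B → ℂ)) :=
  (uniformDisc c.p).prod (Measure.pi fun _ : Fin B => complexNormal)

lemma Params.p_pos (c : Params) : 0 < c.p := by
  linarith [c.r₀_pos, c.r₀_lt_R, c.R_lt_p]

instance (c : Params) : IsProbabilityMeasure (uniformDisc c.p) :=
  isProbabilityMeasure_uniformDisc c.p_pos

instance (c : Params) (B : ℕ) : IsProbabilityMeasure (userLaw c B) := by
  unfold userLaw; infer_instance

instance (c : Params) (B K N : ℕ) : IsProbabilityMeasure (sampleLaw c B K N) := by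
  unfold sampleLaw; infer_instance

lemma sampleLaw_map_users (c : Params) (B K N : ℕ) (n : Fin N) :
    (sampleLaw c B K N).map (fun ω (k : Fin K) => (ω.1 k, fun i : Fin B => ω.2 (i, k, n))) =
      Measure.pi fun _ : Fin K => userLaw c B := by
  have h1 := (measurePreserving_arrowProdEquivProdArrow Plane (Fin B → ℂ) (Fin K)
    (fun _ => uniformDisc c.p) (fun _ => Measure.pi fun _ : Fin B => complexNormal)).symm.map_eq
  have h2 : Measurable (fun v : Fin B × Fin K × Fin N → ℂ => fun (k : Fin K) (i : Fin B) =>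
    v (i, k, n)) := by fun_prop
  unfold userLaw
  rw [← h1, ← pi_map_curry_block B K N n]
  conv_rhs => rw [← Measure.map_id (μ := Measure.pi fun _ : Fin K => uniformDisc c.p)]
  rw [Measure.map_prod_map _ _ measurable_id h2, Measure.map_map (by fun_prop) (by fun_prop)]
  rfl

lemma sampleLaw_forall_user (c : Params) (B K N : ℕ) (n : Fin N)
    {A : Set (Plane × (Fin B → ℂ))} (hA : MeasurableSet A) :
    sampleLaw c B K N {ω | ∀ k, (ω.1 k, fun i : Fin B => ω.2 (i, k, n)) ∈ A} =
      userLaw c B A ^ K := by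
  have h := congrArg (fun μ => μ (Set.univ.pi fun _ => A)) (sampleLaw_map_users c B K N n)
  rw [Measure.map_apply (by fun_prop) (MeasurableSet.univ_pi fun _ => hA), Measure.pi_pi] at h
  simpa [Set.preimage, Set.mem_pi] using h

/-! ### Channel gains -/

/-- The mean channel gain at `z` of a transmitter at `a`. -/
noncomputable def gain (c : Params) (a z : Plane) : ℝ := (c.β * truncDist c a z ^ (-c.α)) ^ 2

/-- The fraction of the area of the network covered by the disc of radius `r₀`. -/
noncomputable def Params.ρ (c : Params) : ℝ := c.r₀ ^ 2 / c.p ^ 2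

/-- The largest possible ratio of two channel gains. -/
noncomputable def Params.spread (c : Params) : ℝ :=
  (2 * c.p) ^ (2 * c.α) * c.r₀ ^ (-2 * c.α)

/-- The function `x ↦ e^{x/σ} ∏ⱼ (1 + aⱼ x)`. -/
noncomputable def growth {ι : Type*} (σ : ℝ) (s : Finset ι) (a : ι → ℝ) (x : ℝ) : ℝ :=
  Real.exp (x / σ) * ∏ j ∈ s, (1 + a j * x)

lemma Params.σ_pos (c : Params) : 0 < c.σ :=
  mul_pos (pow_pos c.β_pos 2) (Real.rpow_pos_of_pos c.r₀_pos _)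

lemma Params.ρ_pos (c : Params) : 0 < c.ρ := by
  have := c.r₀_pos; have := c.p_pos; unfold Params.ρ; positivity

lemma Params.r₀_lt_p (c : Params) : c.r₀ < c.p := c.r₀_lt_R.trans c.R_lt_p

lemma Params.ρ_lt_one (c : Params) : c.ρ < 1 := by
  have := c.r₀_pos; have := c.r₀_lt_p
  rw [Params.ρ, div_lt_one (by nlinarith)]
  nlinarith

lemma Params.spread_eq (c : Params) : c.spread = (2 * c.p / c.r₀) ^ (2 * c.α) := by
  rw [Params.spread, Real.div_rpow (by linarith [c.p_pos]) c.r₀_pos.le, neg_mul,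
    Real.rpow_neg c.r₀_pos.le, div_eq_mul_inv]

lemma Params.one_lt_spread (c : Params) : 1 < c.spread := by
  rw [c.spread_eq]
  have := c.r₀_pos; have := c.r₀_lt_p
  refine Real.one_lt_rpow ?_ (by linarith [c.one_lt_α])
  rw [one_lt_div c.r₀_pos]; linarith

lemma truncDist_pos (c : Params) (a z : Plane) : 0 < truncDist c a z :=
  c.r₀_pos.trans_le (le_max_left _ _)

lemma gain_eq (c : Params) (a z : Plane) :
    gain c a z = c.σ * ((truncDist c a z / c.r₀) ^ (2 * c.α))⁻¹ := by
  have h := truncDist_pos c a z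
  have h0 := c.r₀_pos
  rw [gain, mul_pow, ← Real.rpow_natCast (_ ^ (-c.α)), ← Real.rpow_mul h.le, Params.σ,
    Real.div_rpow h.le h0.le, inv_div, neg_mul 2 c.α, Real.rpow_neg h0.le,
    show -c.α * ((2 : ℕ) : ℝ) = -(2 * c.α) by push_cast; ring, Real.rpow_neg h.le, mul_div_assoc']
  have : c.r₀ ^ (2 * c.α) ≠ 0 := (Real.rpow_pos_of_pos h0 _).ne'
  field_simp

lemma gain_pos (c : Params) (a z : Plane) : 0 < gain c a z := by
  rw [gain]
  have := Real.rpow_pos_of_pos (truncDist_pos c a z) (-c.α)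
  have := c.β_pos
  positivity

lemma one_le_truncDist_div (c : Params) (a z : Plane) : 1 ≤ truncDist c a z / c.r₀ := by
  rw [one_le_div c.r₀_pos]; exact le_max_left _ _

lemma gain_le (c : Params) (a z : Plane) : gain c a z ≤ c.σ := by
  rw [gain_eq]
  refine mul_le_of_le_one_right c.σ_pos.le (inv_le_one_of_one_le₀ ?_)
  exact Real.one_le_rpow (one_le_truncDist_div c a z) (by linarith [c.one_lt_α])

lemma gain_of_dist_le (c : Params) {a z : Plane} (h : dist z a ≤ c.r₀) : gain c a z = c.σ := by
  rw [gain_eq, truncDist, max_eq_left h, div_self c.r₀_pos.ne']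
  simp

lemma measurable_gain (c : Params) (a : Plane) : Measurable (gain c a) := by
  unfold gain truncDist
  fun_prop

/-- Truncated distances from transmitters to points of the network lie between r₀ and 2p, while no
gain exceeds σ. -/
lemma le_spread_mul_gain (c : Params) {a b z : Plane} (hz : ‖z‖ ≤ c.p) (ha : ‖a‖ ≤ c.p - c.R) :
    gain c b z ≤ c.spread * gain c a z := by
  refine (gain_le c b z).trans ?_
  have h0 := c.r₀_pos
  have h1 : truncDist c a z ≤ 2 * c.p := by
    refine max_le (by linarith [c.r₀_lt_p]) ?_
    rw [dist_eq_norm]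
    refine (norm_sub_le z a).trans ?_
    linarith [c.r₀_lt_R]
  rw [gain_eq, c.spread_eq]
  have h2 : (truncDist c a z / c.r₀) ^ (2 * c.α) ≤ (2 * c.p / c.r₀) ^ (2 * c.α) := by
    refine Real.rpow_le_rpow (by linarith [one_le_truncDist_div c a z]) ?_
      (by linarith [c.one_lt_α])
    gcongr
  have h3 : 0 < (truncDist c a z / c.r₀) ^ (2 * c.α) :=
    Real.rpow_pos_of_pos (by linarith [one_le_truncDist_div c a z]) _
  rw [mul_comm, mul_assoc]
  refine le_mul_of_one_le_right c.σ_pos.le ?_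
  rw [inv_mul_eq_div, one_le_div h3]
  exact h2

/-- Since α > 1 and the normalised distance is at least one, the exponent 2α may be lowered to 2.
The sublevel sets then are discs of area proportional to the level, which makes the average over
positions explicit. -/
lemma le_div_gain (c : Params) (a z : Plane) {x : ℝ} (hx : 0 ≤ x) :
    x / c.σ * max 1 ((dist z a / c.r₀) ^ 2) ≤ x / gain c a z := by
  have h1 := one_le_truncDist_div c a z
  have h2 : max 1 ((dist z a / c.r₀) ^ 2) ≤ (truncDist c a z / c.r₀) ^ (2 * c.α) := by
    calc max 1 ((dist z a / c.r₀) ^ 2) ≤ (truncDist c a z / c.r₀) ^ 2 := by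
          refine max_le (one_le_pow₀ h1) ?_
          have := c.r₀_pos
          gcongr
          exact le_max_right _ _
      _ = (truncDist c a z / c.r₀) ^ (2 : ℝ) := by norm_cast
      _ ≤ _ := Real.rpow_le_rpow_of_exponent_le h1 (by linarith [c.one_lt_α])
  rw [gain_eq, ← div_div, div_inv_eq_mul]
  have := c.σ_pos
  gcongr

/-! ### Two-sided bounds for the SINR tail of one user -/

/-- The signal to interference and noise ratio of one user on one resource block. -/
noncomputable def sinr (c : Params) {B : ℕ} (tx : Fin B → Plane) (q : Fin B → ℝ) (i : Fin B)
    (y : Plane × (Fin B → ℂ)) : ℝ :=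
  gain c (tx i) y.1 * ‖y.2 i‖ ^ 2 /
    (1 + ∑ j ∈ Finset.univ.erase i, gain c (tx j) y.1 * ‖y.2 j‖ ^ 2 * q j)

lemma measurable_sinr (c : Params) {B : ℕ} (tx : Fin B → Plane) (q : Fin B → ℝ) (i : Fin B) :
    Measurable (sinr c tx q i) := by
  have := measurable_gain c
  unfold sinr
  fun_prop

lemma userLaw_sinr_gt (c : Params) {B : ℕ} (tx : Fin B → Plane) {q : Fin B → ℝ}
    (hq : ∀ j, 0 ≤ q j) (i : Fin B) {x : ℝ} (hx : 0 ≤ x) :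
    userLaw c B {y | x < sinr c tx q i y} =
      ∫⁻ z, ENNReal.ofReal (Real.exp (-(x / gain c (tx i) z)) * ∏ j ∈ Finset.univ.erase i,
        (1 + x * q j * gain c (tx j) z / gain c (tx i) z)⁻¹) ∂uniformDisc c.p := by
  rw [userLaw, Measure.prod_apply (measurableSet_lt measurable_const (measurable_sinr c tx q i))]
  refine lintegral_congr fun z => ?_
  exact pi_complexNormal_outage i (fun j => gain c (tx j) z) q (fun j => gain_pos c _ z) hq hx

lemma uniformDisc_closedBall_le (a : Plane) {r p : ℝ} (hr : 0 ≤ r) (hp : 0 < p) :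
    uniformDisc p (Metric.closedBall a r) ≤ ENNReal.ofReal (r ^ 2 / p ^ 2) := by
  rw [uniformDisc, cond_apply Metric.isClosed_closedBall.measurableSet]
  calc _ ≤ (volume (Metric.closedBall (0 : Plane) p))⁻¹ * volume (Metric.closedBall a r) := by
        gcongr; exact Set.inter_subset_right
    _ = _ := by
        have := Real.pi_pos
        rw [volume_closedBall_plane, volume_closedBall_plane, ← ENNReal.ofReal_pow hr,
          ← ENNReal.ofReal_pow hp.le, ← ENNReal.ofReal_mul (by positivity),
          ← ENNReal.ofReal_mul (by positivity), ← ENNReal.ofReal_inv_of_pos (by positivity),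
          ← ENNReal.ofReal_mul (by positivity)]
        congr 1; field_simp

lemma uniformDisc_closedBall (a : Plane) {r p : ℝ} (hr : 0 ≤ r) (hp : 0 < p)
    (ha : ‖a‖ + r ≤ p) :
    uniformDisc p (Metric.closedBall a r) = ENNReal.ofReal (r ^ 2 / p ^ 2) := by
  rw [uniformDisc, cond_apply Metric.isClosed_closedBall.measurableSet,
    Set.inter_eq_right.2 (Metric.closedBall_subset_closedBall' (by rw [dist_zero_right]; linarith))]
  have := Real.pi_pos
  rw [volume_closedBall_plane, volume_closedBall_plane, ← ENNReal.ofReal_pow hr,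
    ← ENNReal.ofReal_pow hp.le, ← ENNReal.ofReal_mul (by positivity),
    ← ENNReal.ofReal_mul (by positivity), ← ENNReal.ofReal_inv_of_pos (by positivity),
    ← ENNReal.ofReal_mul (by positivity)]
  congr 1; field_simp

lemma growth_pos {ι : Type*} {σ : ℝ} {s : Finset ι} {a : ι → ℝ} (ha : ∀ j, 0 ≤ a j) {x : ℝ}
    (hx : 0 ≤ x) : 0 < growth σ s a x :=
  mul_pos (Real.exp_pos _) (Finset.prod_pos fun j _ => by nlinarith [mul_nonneg (ha j) hx])

/-- Only users within r₀ of transmitter `i` are kept. Their own gain is σ, so every interference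
ratio is at most one. Their disc lies inside the network because r₀ < R, hence has probability
exactly ρ. -/
lemma ofReal_le_userLaw_sinr_gt (c : Params) {B : ℕ} (tx : Fin B → Plane) {q : Fin B → ℝ}
    (hq : ∀ j, 0 ≤ q j) (i : Fin B) (hi : ‖tx i‖ ≤ c.p - c.R) {x : ℝ} (hx : 0 ≤ x) :
    ENNReal.ofReal (c.ρ / growth c.σ (Finset.univ.erase i) q x) ≤
      userLaw c B {y | x < sinr c tx q i y} := by
  rw [userLaw_sinr_gt c tx hq i hx]
  calc _ = ∫⁻ z in Metric.closedBall (tx i) c.r₀,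
        ENNReal.ofReal (growth c.σ (Finset.univ.erase i) q x)⁻¹ ∂uniformDisc c.p := by
        rw [setLIntegral_const, uniformDisc_closedBall _ c.r₀_pos.le c.p_pos
          (by linarith [c.r₀_lt_R]), ← ENNReal.ofReal_mul (inv_nonneg.2 (growth_pos hq hx).le)]
        congr 1
        rw [Params.ρ]; ring
    _ ≤ ∫⁻ z in Metric.closedBall (tx i) c.r₀, ENNReal.ofReal (Real.exp (-(x / gain c (tx i) z)) *
        ∏ j ∈ Finset.univ.erase i,
        (1 + x * q j * gain c (tx j) z / gain c (tx i) z)⁻¹) ∂uniformDisc c.p := by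
        refine setLIntegral_mono' Metric.isClosed_closedBall.measurableSet fun z hz => ?_
        refine ENNReal.ofReal_le_ofReal ?_
        rw [gain_of_dist_le c (Metric.mem_closedBall.1 hz), growth, mul_inv, Real.exp_neg,
          Finset.prod_inv_distrib]
        have hσ := c.σ_pos
        have h1 : ∀ j, 0 < 1 + x * q j * gain c (tx j) z / c.σ := fun j => by
          have := hq j; have := gain_pos c (tx j) z; positivity
        refine mul_le_mul_of_nonneg_left ?_ (by positivity)
        refine inv_anti₀ (Finset.prod_pos fun j _ => h1 j)
          (Finset.prod_le_prod (fun j _ => (h1 j).le) fun j _ => ?_)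
        have h2 : gain c (tx j) z / c.σ ≤ 1 := (div_le_one hσ).2 (gain_le c _ z)
        have h3 : 0 ≤ x * q j := mul_nonneg hx (hq j)
        rw [mul_div_assoc]
        nlinarith
    _ ≤ _ := setLIntegral_le_lintegral _ _

lemma lintegral_mul_exp_neg_mul {y : ℝ} (hy : 0 < y) :
    ∫⁻ s in Set.Ioi (1 : ℝ), ENNReal.ofReal (y * Real.exp (-y * s) * s) =
      ENNReal.ofReal ((1 + 1 / y) * Real.exp (-y)) := by
  have hd : ∀ x : ℝ, HasDerivAt (fun s => -((s + 1 / y) * Real.exp (-y * s)))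
      (y * Real.exp (-y * x) * x) x := by
    intro x
    have h1 := ((hasDerivAt_id x).add_const (1 / y)).mul
      (((hasDerivAt_id x).const_mul (-y)).exp)
    refine h1.neg.congr_deriv ?_
    simp only [id]; field_simp; ring
  have hnn : ∀ x ∈ Set.Ioi (1 : ℝ), 0 ≤ y * Real.exp (-y * x) * x := by
    intro x hx
    have : 0 ≤ x := zero_le_one.trans (le_of_lt hx)
    positivity
  have ht : Tendsto (fun s => -((s + 1 / y) * Real.exp (-y * s))) atTop (nhds (-0)) := by
    refine Tendsto.neg ?_
    have h1 := (Real.tendsto_pow_mul_exp_neg_atTop_nhds_zero 1).comp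
      (tendsto_id.const_mul_atTop hy)
    have h2 := (Real.tendsto_pow_mul_exp_neg_atTop_nhds_zero 0).comp
      (tendsto_id.const_mul_atTop hy)
    have h3 := (h1.const_mul (1 / y)).add (h2.const_mul (1 / y))
    simp only [mul_zero, add_zero] at h3
    refine h3.congr fun s => ?_
    simp; field_simp
  rw [← ofReal_integral_eq_lintegral_ofReal
    (integrableOn_Ioi_deriv_of_nonneg' (fun x _ => hd x) hnn ht)
    ((ae_restrict_iff' measurableSet_Ioi).2 (ae_of_all _ hnn)),
    integral_Ioi_of_hasDerivAt_of_nonneg' (fun x _ => hd x) hnn ht]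
  congr 1; simp

lemma lintegral_Ioi_mul_exp_neg (m : ℝ) {y : ℝ} (hy : 0 < y) :
    ∫⁻ s in Set.Ioi m, ENNReal.ofReal (y * Real.exp (-y * s)) =
      ENNReal.ofReal (Real.exp (-y * m)) := by
  have hd : ∀ x : ℝ, HasDerivAt (fun s => -(Real.exp (-y * s)))
      (y * Real.exp (-y * x)) x := by
    intro x
    refine ((hasDerivAt_id x).const_mul (-y)).exp.neg.congr_deriv ?_
    simp only [id]; ring
  have hnn : ∀ x ∈ Set.Ioi m, 0 ≤ y * Real.exp (-y * x) := fun x hx => by positivity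
  have ht : Tendsto (fun s => -(Real.exp (-y * s))) atTop (nhds (-0)) :=
    (Real.tendsto_exp_atBot.comp (tendsto_id.const_mul_atTop_of_neg (by linarith))).neg
  rw [← ofReal_integral_eq_lintegral_ofReal
    (integrableOn_Ioi_deriv_of_nonneg' (fun x _ => hd x) hnn ht)
    ((ae_restrict_iff' measurableSet_Ioi).2 (ae_of_all _ hnn)),
    integral_Ioi_of_hasDerivAt_of_nonneg' (fun x _ => hd x) hnn ht]
  congr 1; simp

/-- Layer cake: e^{-ym} is the integral of y e^{-ys} over s > m. After swapping the integrals, the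
inner event is a disc of radius r√s, of probability at most s r²/p². -/
lemma lintegral_exp_neg_max_dist_le (a : Plane) {r p y : ℝ} (hr : 0 < r) (hp : 0 < p)
    (hy : 0 < y) :
    ∫⁻ z, ENNReal.ofReal (Real.exp (-y * max 1 ((dist z a / r) ^ 2))) ∂uniformDisc p ≤
      ENNReal.ofReal (r ^ 2 / p ^ 2 * ((1 + 1 / y) * Real.exp (-y))) := by
  have := isProbabilityMeasure_uniformDisc hp
  have hset : MeasurableSet {w : Plane × ℝ | (dist w.1 a / r) ^ 2 < w.2} :=
    measurableSet_lt (by fun_prop) (by fun_prop)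
  have h1 : ∀ z : Plane, ENNReal.ofReal (Real.exp (-y * max 1 ((dist z a / r) ^ 2))) =
      ∫⁻ s in Set.Ioi (1 : ℝ), {w : Plane × ℝ | (dist w.1 a / r) ^ 2 < w.2}.indicator
        (fun w => ENNReal.ofReal (y * Real.exp (-y * w.2))) (z, s) := by
    intro z
    rw [← lintegral_Ioi_mul_exp_neg _ hy]
    have h2 : ∀ s : ℝ, {w : Plane × ℝ | (dist w.1 a / r) ^ 2 < w.2}.indicator
        (fun w => ENNReal.ofReal (y * Real.exp (-y * w.2))) (z, s) =
        (Set.Ioi ((dist z a / r) ^ 2)).indicator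
          (fun s => ENNReal.ofReal (y * Real.exp (-y * s))) s := fun s => by
      simp [Set.indicator]
    simp_rw [h2]
    rw [lintegral_indicator measurableSet_Ioi, Measure.restrict_restrict measurableSet_Ioi,
      Set.Ioi_inter_Ioi, sup_comm]
  simp_rw [h1]
  rw [lintegral_lintegral_swap (f := fun z s => {w : Plane × ℝ | (dist w.1 a / r) ^ 2 < w.2}.indicator
        (fun w => ENNReal.ofReal (y * Real.exp (-y * w.2))) (z, s))
    (Measurable.aemeasurable (Measurable.indicator (by fun_prop) hset))]
  rw [ENNReal.ofReal_mul (by positivity), ← lintegral_mul_exp_neg_mul hy,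
    ← lintegral_const_mul _ (by fun_prop)]
  refine setLIntegral_mono' measurableSet_Ioi fun s hs => ?_
  have hs : 1 < s := hs
  calc _ ≤ ∫⁻ z, (Metric.closedBall a (r * Real.sqrt s)).indicator
        (fun _ => ENNReal.ofReal (y * Real.exp (-y * s))) z ∂uniformDisc p := by
        refine lintegral_mono fun z => ?_
        simp only [Set.indicator, Set.mem_ofPred_eq, Metric.mem_closedBall]
        split_ifs with h h'
        · exact le_rfl
        · exfalso; apply h'
          have := Real.le_sqrt_of_sq_le h.le
          rw [div_le_iff₀ hr] at this
          linarith
        · exact zero_le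
        · exact le_rfl
    _ = ENNReal.ofReal (y * Real.exp (-y * s)) *
        uniformDisc p (Metric.closedBall a (r * Real.sqrt s)) := by
        rw [lintegral_indicator_const Metric.isClosed_closedBall.measurableSet]
    _ ≤ ENNReal.ofReal (y * Real.exp (-y * s)) *
        ENNReal.ofReal ((r * Real.sqrt s) ^ 2 / p ^ 2) := by
        gcongr
        exact uniformDisc_closedBall_le a (by positivity) hp
    _ = _ := by
        rw [← ENNReal.ofReal_mul (by positivity), ← ENNReal.ofReal_mul (by positivity), mul_pow,
          Real.sq_sqrt (by linarith)]
        congr 1; ring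

/-- Bounding every gain ratio below by 1/spread freezes the interference factors, and only the
exponential of the user's own gain is averaged over the position. -/
lemma userLaw_sinr_gt_le (c : Params) {B : ℕ} (tx : Fin B → Plane)
    (htx : ∀ i, ‖tx i‖ ≤ c.p - c.R) {q : Fin B → ℝ}
    (hq : ∀ j, 0 ≤ q j) (i : Fin B) {x : ℝ} (hx : 0 < x) :
    userLaw c B {y | x < sinr c tx q i y} ≤
      ENNReal.ofReal (c.ρ * (1 + c.σ / x) /
        growth c.σ (Finset.univ.erase i) (fun j => q j / c.spread) x) := by
  have hD := c.one_lt_spread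
  have hσ := c.σ_pos
  set Q : ℝ := ∏ j ∈ Finset.univ.erase i, (1 + q j / c.spread * x)⁻¹ with hQ
  have hq' : ∀ j, 0 < 1 + q j / c.spread * x := fun j => by have := hq j; positivity
  have hQ0 : 0 ≤ Q := Finset.prod_nonneg fun j _ => (inv_pos.2 (hq' j)).le
  rw [userLaw_sinr_gt c tx hq i hx.le]
  have hz : ∀ᵐ z ∂uniformDisc c.p, z ∈ Metric.closedBall (0 : Plane) c.p :=
    ae_cond_mem Metric.isClosed_closedBall.measurableSet
  calc _ ≤ ∫⁻ z, ENNReal.ofReal Q *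
        ENNReal.ofReal (Real.exp (-(x / c.σ) * max 1 ((dist z (tx i) / c.r₀) ^ 2)))
          ∂uniformDisc c.p := by
        refine lintegral_mono_ae (hz.mono fun z hz => ?_)
        rw [← ENNReal.ofReal_mul hQ0]
        refine ENNReal.ofReal_le_ofReal ?_
        rw [mul_comm Q]
        refine mul_le_mul ?_ ?_ ?_ (Real.exp_pos _).le
        · refine Real.exp_le_exp.2 ?_
          have := le_div_gain c (tx i) z hx.le
          linarith
        · refine Finset.prod_le_prod (fun j _ => ?_) fun j _ => inv_anti₀ (hq' j) ?_
          · have := hq j; have := gain_pos c (tx j) z; have := gain_pos c (tx i) z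
            positivity
          · have h1 := le_spread_mul_gain c (a := tx j) (b := tx i) (mem_closedBall_zero_iff.1 hz) (htx j)
            have h2 : 1 / c.spread ≤ gain c (tx j) z / gain c (tx i) z := by
              rw [div_le_div_iff₀ (by linarith) (gain_pos c _ z)]; linarith
            have h3 := mul_le_mul_of_nonneg_left h2 (mul_nonneg hx.le (hq j))
            rw [← mul_div_assoc, ← mul_div_assoc] at h3
            have h4 : q j / c.spread * x = x * q j * 1 / c.spread := by ring
            linarith
        · refine Finset.prod_nonneg fun j _ => ?_
          have := hq j; have := gain_pos c (tx j) z; have := gain_pos c (tx i) z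
          positivity
    _ = ENNReal.ofReal Q * ∫⁻ z, ENNReal.ofReal (Real.exp (-(x / c.σ) *
          max 1 ((dist z (tx i) / c.r₀) ^ 2))) ∂uniformDisc c.p :=
        lintegral_const_mul _ (by fun_prop)
    _ ≤ ENNReal.ofReal Q * ENNReal.ofReal (c.r₀ ^ 2 / c.p ^ 2 *
          ((1 + 1 / (x / c.σ)) * Real.exp (-(x / c.σ)))) := by
        gcongr
        exact lintegral_exp_neg_max_dist_le _ c.r₀_pos c.p_pos (div_pos hx hσ)
    _ = _ := by
        rw [← ENNReal.ofReal_mul hQ0, growth, hQ, Finset.prod_inv_distrib, Real.exp_neg, Params.ρ,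
          one_div_div]
        congr 1
        rw [div_eq_mul_inv _ (Real.exp _ * _), mul_inv]
        ring

/-! ### The function x ↦ e^{x/σ} ∏ (1 + aⱼ x) -/

section growth

variable {ι : Type*} {σ : ℝ} {s : Finset ι} {a : ι → ℝ}

lemma growth_zero : growth σ s a 0 = 1 := by simp [growth]

/-- The product is monotone, so `growth` rises at least as fast as its exponential factor. This
gives uniqueness of thresholds and the exponential estimates on both sides of a threshold. -/
lemma exp_mul_growth_le (ha : ∀ j, 0 ≤ a j) {x y : ℝ} (hx : 0 ≤ x) (hxy : x ≤ y) :
    Real.exp ((y - x) / σ) * growth σ s a x ≤ growth σ s a y := by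
  rw [growth, growth, ← mul_assoc, ← Real.exp_add, ← add_div, sub_add_cancel]
  refine mul_le_mul_of_nonneg_left (Finset.prod_le_prod (fun j _ => ?_) fun j _ => ?_)
    (Real.exp_pos _).le
  · have := ha j; positivity
  · have := mul_le_mul_of_nonneg_left hxy (ha j); linarith

lemma exp_le_growth (ha : ∀ j, 0 ≤ a j) {x : ℝ} (hx : 0 ≤ x) :
    Real.exp (x / σ) ≤ growth σ s a x := by
  simpa [growth_zero] using exp_mul_growth_le (σ := σ) (s := s) ha le_rfl hx

lemma growth_lt (hσ : 0 < σ) (ha : ∀ j, 0 ≤ a j) {x y : ℝ} (hx : 0 ≤ x) (hxy : x < y) :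
    growth σ s a x < growth σ s a y := by
  refine lt_of_lt_of_le ?_ (exp_mul_growth_le ha hx hxy.le)
  exact lt_mul_of_one_lt_left (growth_pos ha hx)
    (Real.one_lt_exp_iff.2 (div_pos (sub_pos.2 hxy) hσ))

lemma le_of_growth_le (hσ : 0 < σ) (ha : ∀ j, 0 ≤ a j) {x y : ℝ} (hy : 0 ≤ y)
    (h : growth σ s a x ≤ growth σ s a y) : x ≤ y := by
  by_contra! h'
  exact absurd (growth_lt (s := s) hσ ha hy h') (not_lt.2 h)

lemma continuous_growth : Continuous (growth σ s a) := by
  unfold growth; fun_prop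

lemma exists_growth_eq (hσ : 0 < σ) (ha : ∀ j, 0 ≤ a j) {t : ℝ} (ht : 1 ≤ t) :
    ∃ x, 0 ≤ x ∧ growth σ s a x = t := by
  have h0 : 0 ≤ σ * Real.log t := mul_nonneg hσ.le (Real.log_nonneg ht)
  have h1 : t ≤ growth σ s a (σ * Real.log t) := by
    refine le_trans ?_ (exp_le_growth ha h0)
    rw [mul_div_cancel_left₀ _ hσ.ne', Real.exp_log (by linarith)]
  obtain ⟨x, hx, hxt⟩ := intermediate_value_Icc h0 continuous_growth.continuousOn
    (show t ∈ Set.Icc (growth σ s a 0) _ from ⟨by rwa [growth_zero], h1⟩)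
  exact ⟨x, hx.1, hxt⟩

lemma le_log_growth (hσ : 0 < σ) (ha : ∀ j, 0 ≤ a j) {x : ℝ} (hx : 0 ≤ x) :
    x ≤ σ * Real.log (growth σ s a x) := by
  rw [← div_le_iff₀' hσ, Real.le_log_iff_exp_le (growth_pos ha hx)]
  exact exp_le_growth ha hx

lemma growth_div_le (hσ : 0 < σ) (ha : ∀ j, 0 ≤ a j) {D : ℝ} (hD : 1 ≤ D) {x : ℝ} (hx : 0 ≤ x) :
    growth σ s a (x / D) ≤ growth σ s (fun j => a j / D) x := by
  rw [growth, growth]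
  have h1 : ∀ j, 1 + a j * (x / D) = 1 + a j / D * x := fun j => by ring
  simp_rw [h1]
  refine mul_le_mul_of_nonneg_right (Real.exp_le_exp.2 ?_) (Finset.prod_nonneg fun j _ => ?_)
  · gcongr; exact div_le_self hx hD
  · have := ha j; positivity

/-- Each factor grows by at most 2, and lowering the argument by a quarter frees e^{x/(4σ)}, which
pays for 2^{|s|}. -/
lemma growth_two_mul_le (hσ : 0 < σ) (ha : ∀ j, 0 ≤ a j) {x : ℝ} (hx : 0 ≤ x)
    (hs : s.card * Real.log 2 ≤ x / (4 * σ)) :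
    growth σ s (fun j => 2 * a j) (3 / 4 * x) ≤ growth σ s a x := by
  have h1 : ∏ j ∈ s, (1 + 2 * a j * (3 / 4 * x)) ≤ 2 ^ s.card * ∏ j ∈ s, (1 + a j * x) := by
    rw [← Finset.prod_const, ← Finset.prod_mul_distrib]
    refine Finset.prod_le_prod (fun j _ => ?_) fun j _ => ?_
    · have := ha j; positivity
    · nlinarith [mul_nonneg (ha j) hx]
  have h2 : (2 : ℝ) ^ s.card ≤ Real.exp (x / (4 * σ)) := by
    rw [← Real.exp_log (show (0 : ℝ) < 2 ^ s.card by positivity), Real.log_pow]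
    exact Real.exp_le_exp.2 hs
  have h3 : 0 ≤ ∏ j ∈ s, (1 + a j * x) := Finset.prod_nonneg fun j _ => by
    have := ha j; positivity
  calc growth σ s (fun j => 2 * a j) (3 / 4 * x)
      ≤ Real.exp (3 / 4 * x / σ) * (Real.exp (x / (4 * σ)) * ∏ j ∈ s, (1 + a j * x)) := by
        refine mul_le_mul_of_nonneg_left (h1.trans ?_) (Real.exp_pos _).le
        exact mul_le_mul_of_nonneg_right h2 h3
    _ = growth σ s a x := by
        rw [growth, ← mul_assoc, ← Real.exp_add]
        congr 2; field_simp; ring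

lemma growth_le_pow {b : ℝ} (ha : ∀ j, 0 ≤ a j) (hb : ∀ j, a j ≤ b) {x : ℝ} (hx : 0 ≤ x) :
    growth σ s a x ≤ Real.exp (x / σ) * (1 + b * x) ^ s.card := by
  rw [growth, ← Finset.prod_const]
  refine mul_le_mul_of_nonneg_left (Finset.prod_le_prod (fun j _ => ?_) fun j _ => ?_)
    (Real.exp_pos _).le
  · have := ha j; positivity
  · have := mul_le_mul_of_nonneg_right (hb j) hx; linarith

end growth

/-! ### The deterministic problem OP and the threshold l̄ -/

/-- The ratio of the gains at distances `d` and `r₀`. -/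
noncomputable def Params.loss (c : Params) (d : ℝ) : ℝ := d ^ (2 * c.α) * c.r₀ ^ (-2 * c.α)

lemma Params.loss_pos (c : Params) {d : ℝ} (hd : 0 < d) : 0 < c.loss d :=
  mul_pos (Real.rpow_pos_of_pos hd _) (Real.rpow_pos_of_pos c.r₀_pos _)

lemma Params.loss_r₀ (c : Params) : c.loss c.r₀ = 1 := by
  rw [Params.loss, ← Real.rpow_add c.r₀_pos]; simp

lemma Params.loss_two_p (c : Params) : c.loss (2 * c.p) = c.spread := rfl

/-- In this form x is the point where the model tail ρ / growth equals 1/t. -/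
lemma mem_opFeasible {c : Params} {B N : ℕ} {d t : ℝ}
    {z : (Fin B → Fin N → ℝ) × (Fin B → Fin N → ℝ)} :
    z ∈ opFeasible c B N d t ↔ z.1 ∈ powers c B N ∧ ∀ i n, 0 ≤ z.2 i n ∧
      growth c.σ (Finset.univ.erase i) (fun j => z.1 j n / c.loss d) (z.2 i n) = c.ρ * t := by
  have h1 : c.r₀ ^ 2 * t / c.p ^ 2 = c.ρ * t := by rw [Params.ρ]; ring
  simp only [opFeasible, Set.mem_ofPred_eq, h1]
  refine and_congr_right fun _ => forall_congr' fun i => forall_congr' fun n =>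
    and_congr_right fun _ => ?_
  rw [eq_comm]
  have h2 : ∀ j, 1 + z.1 j n * z.2 i n / (d ^ (2 * c.α) * c.r₀ ^ (-2 * c.α)) =
    1 + z.1 j n / c.loss d * z.2 i n := fun j => by rw [Params.loss]; ring
  simp_rw [h2]
  rfl

lemma powers_le {c : Params} {B N : ℕ} {q : Fin B → Fin N → ℝ} (hq : q ∈ powers c B N)
    (i : Fin B) (n : Fin N) : q i n ≤ c.Pcon :=
  (Finset.single_le_sum (fun n _ => hq.1 i n) (Finset.mem_univ n)).trans (hq.2 i)

lemma isCompact_powers (c : Params) (B N : ℕ) : IsCompact (powers c B N) := by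
  refine (isCompact_Icc (a := (0 : Fin B → Fin N → ℝ)) (b := fun _ _ => c.Pcon)).of_isClosed_subset
    ?_ fun q hq => ⟨fun i n => hq.1 i n, fun i n => powers_le hq i n⟩
  have : powers c B N = (⋂ i, ⋂ n, {q : Fin B → Fin N → ℝ | 0 ≤ q i n}) ∩
      ⋂ i, {q : Fin B → Fin N → ℝ | ∑ n, q i n ≤ c.Pcon} := by
    ext q; simp [powers]
  rw [this]
  exact (isClosed_iInter fun i => isClosed_iInter fun n =>
    isClosed_le continuous_const (by fun_prop)).inter
    (isClosed_iInter fun i => isClosed_le (by fun_prop) continuous_const)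

lemma zero_mem_powers (c : Params) (B N : ℕ) : (0 : Fin B → Fin N → ℝ) ∈ powers c B N :=
  ⟨fun _ _ => le_rfl, fun _ => by simpa using c.Pcon_pos.le⟩

lemma exists_mem_opFeasible {c : Params} {B N : ℕ} {d t : ℝ} (hd : 0 < d) (ht : 1 ≤ c.ρ * t)
    {q : Fin B → Fin N → ℝ} (hq : q ∈ powers c B N) :
    ∃ x, (q, x) ∈ opFeasible c B N d t := by
  choose x hx using fun (i : Fin B) (n : Fin N) => exists_growth_eq (s := Finset.univ.erase i)
    (a := fun j => q j n / c.loss d) c.σ_pos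
    (fun j => div_nonneg (hq.1 j n) (c.loss_pos hd).le) ht
  exact ⟨x, mem_opFeasible.2 ⟨hq, hx⟩⟩

/-- The thresholds are bounded by σ log(ρt), because `growth` dominates its exponential factor. -/
lemma isCompact_opFeasible (c : Params) (B N : ℕ) {d t : ℝ} (hd : 0 < d) :
    IsCompact (opFeasible c B N d t) := by
  refine ((isCompact_powers c B N).prod (isCompact_Icc (a := (0 : Fin B → Fin N → ℝ))
    (b := fun _ _ => c.σ * Real.log (c.ρ * t)))).of_isClosed_subset ?_ fun z hz => ?_
  · have : opFeasible c B N d t = (Prod.fst ⁻¹' powers c B N) ∩ ⋂ i, ⋂ n,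
        {z : (Fin B → Fin N → ℝ) × (Fin B → Fin N → ℝ) | 0 ≤ z.2 i n ∧
        c.r₀ ^ 2 * t / c.p ^ 2 = Real.exp (z.2 i n / c.σ) *
          ∏ j ∈ Finset.univ.erase i,
            (1 + z.1 j n * z.2 i n / (d ^ (2 * c.α) * c.r₀ ^ (-2 * c.α)))} := by
      ext z; simp [opFeasible]
    rw [this]
    refine ((isCompact_powers c B N).isClosed.preimage continuous_fst).inter
      (isClosed_iInter fun i => isClosed_iInter fun n => ?_)
    have h1 : IsClosed {z : (Fin B → Fin N → ℝ) × (Fin B → Fin N → ℝ) | 0 ≤ z.2 i n} :=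
      isClosed_le continuous_const (by fun_prop)
    have h2 : IsClosed {z : (Fin B → Fin N → ℝ) × (Fin B → Fin N → ℝ) |
        c.r₀ ^ 2 * t / c.p ^ 2 = Real.exp (z.2 i n / c.σ) * ∏ j ∈ Finset.univ.erase i,
          (1 + z.1 j n * z.2 i n / (d ^ (2 * c.α) * c.r₀ ^ (-2 * c.α)))} :=
      isClosed_eq continuous_const (by fun_prop)
    exact h1.inter h2
  · rw [mem_opFeasible] at hz
    refine ⟨hz.1, fun i n => (hz.2 i n).1, fun i n => ?_⟩
    rw [← (hz.2 i n).2]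
    exact le_log_growth c.σ_pos (fun j => div_nonneg (hz.1.1 j n) (c.loss_pos hd).le) (hz.2 i n).1

lemma opFeasible_nonneg {c : Params} {B N : ℕ} {d t : ℝ}
    {z : (Fin B → Fin N → ℝ) × (Fin B → Fin N → ℝ)} (hz : z ∈ opFeasible c B N d t)
    (i : Fin B) (n : Fin N) : 0 ≤ z.1 i n * z.2 i n :=
  mul_nonneg (hz.1.1 i n) (hz.2 i n).1

lemma isGreatest_OP {c : Params} {B N : ℕ} {d t : ℝ} (hd : 0 < d) (ht : 1 ≤ c.ρ * t) :
    IsGreatest (opObjective '' opFeasible c B N d t) (OP c B N d t) := by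
  have hne : (opFeasible c B N d t).Nonempty :=
    let ⟨x, hx⟩ := exists_mem_opFeasible hd ht (zero_mem_powers c B N)
    ⟨_, hx⟩
  refine ((isCompact_opFeasible c B N hd).image_of_continuousOn ?_).isGreatest_sSup (hne.image _)
  unfold opObjective
  refine continuousOn_finsetSum _ fun i _ => continuousOn_finsetSum _ fun n _ => ?_
  refine ContinuousOn.log (by fun_prop) fun z hz => ?_
  have := opFeasible_nonneg hz i n
  positivity

lemma opObjective_nonneg {c : Params} {B N : ℕ} {d t : ℝ}
    {z : (Fin B → Fin N → ℝ) × (Fin B → Fin N → ℝ)} (hz : z ∈ opFeasible c B N d t) :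
    0 ≤ opObjective z :=
  Finset.sum_nonneg fun i _ => Finset.sum_nonneg fun n _ =>
    Real.log_nonneg (by linarith [opFeasible_nonneg hz i n])

lemma opObjective_le_OP {c : Params} {B N : ℕ} {d t : ℝ} (hd : 0 < d) (ht : 1 ≤ c.ρ * t)
    {z : (Fin B → Fin N → ℝ) × (Fin B → Fin N → ℝ)} (hz : z ∈ opFeasible c B N d t) :
    opObjective z ≤ OP c B N d t :=
  (isGreatest_OP hd ht).2 ⟨z, hz, rfl⟩

lemma OP_nonneg {c : Params} {B N : ℕ} {d t : ℝ} (hd : 0 < d) (ht : 1 ≤ c.ρ * t) :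
    0 ≤ OP c B N d t := by
  obtain ⟨z, hz, h⟩ := (isGreatest_OP (B := B) (N := N) hd ht).1
  rw [← h]; exact opObjective_nonneg hz

lemma OP_pos {c : Params} {B N : ℕ} (hB : 0 < B) (hN : 0 < N) {d t : ℝ} (hd : 0 < d)
    (ht : 1 < c.ρ * t) : 0 < OP c B N d t := by
  have hP := c.Pcon_pos
  have hN' : (0 : ℝ) < N := by exact_mod_cast hN
  have hq : (fun _ _ => c.Pcon / N : Fin B → Fin N → ℝ) ∈ powers c B N := by
    refine ⟨fun _ _ => by positivity, fun _ => ?_⟩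
    simp only [Finset.sum_const, Finset.card_univ, Fintype.card_fin, nsmul_eq_mul]
    rw [mul_div_cancel₀ _ hN'.ne']
  obtain ⟨x, hx⟩ := exists_mem_opFeasible hd ht.le hq
  refine lt_of_lt_of_le ?_ (opObjective_le_OP hd ht.le hx)
  have hx0 : ∀ i n, 0 < x i n := fun i n => by
    obtain ⟨h1, h2⟩ := (mem_opFeasible.1 hx).2 i n
    refine lt_of_le_of_ne h1 fun h => ?_
    simp only [← h, growth_zero] at h2
    linarith
  refine Finset.sum_pos (fun i _ => Finset.sum_pos (fun n _ => Real.log_pos ?_) ⟨⟨0, hN⟩, by simp⟩)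
    ⟨⟨0, hB⟩, by simp⟩
  have := hx0 i n
  simp only [lt_add_iff_pos_right]
  positivity

lemma log_one_add_div_ge {D y : ℝ} (hD : 1 ≤ D) (hy : 0 ≤ y) :
    Real.log (1 + y) ≤ D * Real.log (1 + y / D) := by
  have h1 := one_add_mul_self_le_rpow_one_add (s := y / D) (p := D)
    (by have : 0 ≤ y / D := by positivity
        linarith) hD
  rw [mul_div_cancel₀ _ (by positivity)] at h1
  rw [← Real.log_rpow (by positivity)]
  exact Real.log_le_log (by positivity) h1

/-- With the same powers, the threshold for r₀ is at least x/spread: shrinking the argument shrinks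
the exponential too, not only the interference. Bernoulli's inequality then bounds the loss inside
the logarithm by the factor spread. -/
lemma OP_two_p_le {c : Params} {B N : ℕ} {t : ℝ} (ht : 1 ≤ c.ρ * t) :
    OP c B N (2 * c.p) t ≤ c.spread * OP c B N c.r₀ t := by
  obtain ⟨⟨q, x⟩, hz, h⟩ := (isGreatest_OP (B := B) (N := N) (d := 2 * c.p)
    (by linarith [c.p_pos]) ht).1
  rw [← h]
  have hq : q ∈ powers c B N := hz.1
  obtain ⟨y, hy⟩ := exists_mem_opFeasible c.r₀_pos ht hq
  have hD := c.one_lt_spread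
  refine le_trans ?_ (mul_le_mul_of_nonneg_left (opObjective_le_OP c.r₀_pos ht hy) (by linarith))
  rw [mem_opFeasible] at hz hy
  simp only [opObjective, Finset.mul_sum]
  refine Finset.sum_le_sum fun i _ => Finset.sum_le_sum fun n _ => ?_
  obtain ⟨hx0, hx⟩ := hz.2 i n
  obtain ⟨hy0, hy⟩ := hy.2 i n
  have hle : x i n / c.spread ≤ y i n := by
    refine le_of_growth_le (s := Finset.univ.erase i) (a := fun j => q j n) c.σ_pos
      (fun j => hq.1 j n) hy0 ?_
    simp only [c.loss_r₀, div_one] at hy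
    rw [hy, ← hx]
    exact growth_div_le c.σ_pos (fun j => hq.1 j n) hD.le hx0
  have hqi := hq.1 i n
  refine (log_one_add_div_ge hD.le (mul_nonneg hqi hx0)).trans ?_
  refine mul_le_mul_of_nonneg_left (Real.log_le_log ?_ ?_) (by linarith)
  · simp only at *
    positivity
  · rw [mul_div_assoc]
    have := mul_le_mul_of_nonneg_left hle hqi
    linarith

lemma isLBar_iff {c : Params} {B : ℕ} {t l : ℝ} :
    IsLBar c B (2 * c.p) t l ↔ 0 ≤ l ∧ growth c.σ (Finset.range (B - 1))
      (fun _ => c.Pcon / c.spread) l = c.ρ * t := by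
  have h1 : c.r₀ ^ 2 * t / c.p ^ 2 = c.ρ * t := by rw [Params.ρ]; ring
  rw [IsLBar, h1, growth, eq_comm, Finset.prod_const, Finset.card_range, ← Params.spread,
    div_mul_eq_mul_div, mul_comm c.Pcon]

lemma isLBar_iff_eq_lBar {c : Params} {B : ℕ} {t : ℝ} (ht : 1 ≤ c.ρ * t) (l : ℝ) :
    IsLBar c B (2 * c.p) t l ↔ l = lBar c B (2 * c.p) t := by
  have ha : ∀ _ : ℕ, 0 ≤ c.Pcon / c.spread := fun _ =>
    div_nonneg c.Pcon_pos.le (by linarith [c.one_lt_spread])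
  obtain ⟨m, hm⟩ := exists_growth_eq (s := Finset.range (B - 1)) c.σ_pos ha ht
  have huniq : ∀ l, IsLBar c B (2 * c.p) t l ↔ l = m := by
    intro l
    rw [isLBar_iff]
    constructor
    · rintro ⟨h0, h⟩
      exact le_antisymm (le_of_growth_le c.σ_pos ha hm.1 (h.trans hm.2.symm).le)
        (le_of_growth_le c.σ_pos ha h0 (hm.2.trans h.symm).le)
    · rintro rfl; exact hm
  have : lBar c B (2 * c.p) t = m := by
    rw [lBar]; simp_rw [huniq]; simp
  rw [this, huniq]

/-- l̄ is the threshold when all B - 1 interferers use full power; less interference only raises it.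
-/
lemma lBar_le_of_mem_opFeasible {c : Params} {B N : ℕ} {t : ℝ} (ht : 1 ≤ c.ρ * t)
    {z : (Fin B → Fin N → ℝ) × (Fin B → Fin N → ℝ)} (hz : z ∈ opFeasible c B N (2 * c.p) t)
    (i : Fin B) (n : Fin N) : lBar c B (2 * c.p) t ≤ z.2 i n := by
  have hD := c.one_lt_spread
  have hP := c.Pcon_pos
  obtain ⟨h0, hl⟩ := isLBar_iff.1 ((isLBar_iff_eq_lBar (B := B) ht _).2 rfl)
  rw [mem_opFeasible] at hz
  obtain ⟨hx0, hx⟩ := hz.2 i n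
  refine le_of_growth_le (s := Finset.range (B - 1)) (a := fun _ => c.Pcon / c.spread) c.σ_pos
    (fun _ => by positivity) hx0 ?_
  rw [hl, ← hx, c.loss_two_p]
  refine (growth_le_pow (fun j => div_nonneg (hz.1.1 j n) (by linarith))
    (fun j => div_le_div_of_nonneg_right (powers_le hz.1 j n) (by linarith)) hx0).trans ?_
  rw [growth, Finset.prod_const]
  simp

/-! ### Decoupling of the user allocation and the lower bounds -/

section

/-- Maximizers of the single terms assemble into a joint maximizer. -/
lemma ciSup_sum_sum {ι κ α : Type*} [Fintype ι] [Fintype κ] [Finite α] [Nonempty α]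
    (f : ι → κ → α → ℝ) :
    ⨆ u : ι → κ → α, ∑ i, ∑ n, f i n (u i n) = ∑ i, ∑ n, ⨆ k, f i n k := by
  have hbdd : ∀ i n, BddAbove (Set.range (f i n)) := fun i n => (Set.finite_range _).bddAbove
  refine le_antisymm (ciSup_le fun u => Finset.sum_le_sum fun i _ => Finset.sum_le_sum fun n _ =>
    le_ciSup (hbdd i n) _) ?_
  choose u hu using fun i n => exists_eq_ciSup_of_finite (f := f i n)
  calc ∑ i, ∑ n, ⨆ k, f i n k = ∑ i, ∑ n, f i n (u i n) := by simp_rw [hu]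
    _ ≤ _ := le_ciSup (f := fun u : ι → κ → α => ∑ i, ∑ n, f i n (u i n))
        (Set.finite_range _).bddAbove u

/-- The data of user `k` on resource block `n`. -/
def userData {B K N : ℕ} (n : Fin N) (ω : Sample B K N) (k : Fin K) : Plane × (Fin B → ℂ) :=
  (ω.1 k, fun i => ω.2 (i, k, n))

/-- The rate of the best user of transmitter `i` on resource block `n`. -/
noncomputable def blockRate (c : Params) {B K N : ℕ} (tx : Fin B → Plane)
    (q : Fin B → Fin N → ℝ) (i : Fin B) (n : Fin N) (ω : Sample B K N) : ℝ :=
  ⨆ k : Fin K, Real.log (1 + q i n * sinr c tx (fun j => q j n) i (userData n ω k))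

variable {c : Params} {B K N : ℕ} {tx : Fin B → Plane} {q : Fin B → Fin N → ℝ}

lemma snr_eq (ω : Sample B K N) (i : Fin B) (k : Fin K) (n : Fin N) :
    snr c tx ω i k n = gain c (tx i) (ω.1 k) * ‖ω.2 (i, k, n)‖ ^ 2 := by
  rw [snr, norm_mul, mul_pow, Complex.norm_real, Real.norm_eq_abs, sq_abs, gain]

lemma bestRate_eq (hK : 0 < K) (ω : Sample B K N) :
    bestRate c tx q ω = ∑ i, ∑ n, blockRate c tx q i n ω := by
  have : Nonempty (Fin K) := ⟨⟨0, hK⟩⟩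
  simp only [blockRate]
  rw [← ciSup_sum_sum, bestRate]
  refine iSup_congr fun u => Finset.sum_congr rfl fun i _ => Finset.sum_congr rfl fun n _ => ?_
  simp only [snr_eq, sinr, userData]
  congr 2
  ring

lemma sinr_denom_pos {q : Fin B → ℝ} (hq : ∀ j, 0 ≤ q j) (i : Fin B) (y : Plane × (Fin B → ℂ)) :
    1 ≤ 1 + ∑ j ∈ Finset.univ.erase i, gain c (tx j) y.1 * ‖y.2 j‖ ^ 2 * q j := by
  have := Finset.sum_nonneg fun j (_ : j ∈ Finset.univ.erase i) =>
    mul_nonneg (mul_nonneg (gain_pos c (tx j) y.1).le (sq_nonneg ‖y.2 j‖)) (hq j)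
  linarith

lemma sinr_nonneg {q : Fin B → ℝ} (hq : ∀ j, 0 ≤ q j) (i : Fin B) (y : Plane × (Fin B → ℂ)) :
    0 ≤ sinr c tx q i y :=
  div_nonneg (mul_nonneg (gain_pos _ _ _).le (sq_nonneg _))
    (zero_le_one.trans (sinr_denom_pos hq i y))

lemma sinr_le {q : Fin B → ℝ} (hq : ∀ j, 0 ≤ q j) (i : Fin B) (y : Plane × (Fin B → ℂ)) :
    sinr c tx q i y ≤ c.σ * ‖y.2 i‖ ^ 2 :=
  (div_le_self (mul_nonneg (gain_pos _ _ _).le (sq_nonneg _)) (sinr_denom_pos hq i y)).trans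
    (mul_le_mul_of_nonneg_right (gain_le _ _ _) (sq_nonneg _))

lemma measurable_userData (n : Fin N) (k : Fin K) :
    Measurable fun ω : Sample B K N => userData n ω k := by
  unfold userData; fun_prop

lemma measurable_blockRate (i : Fin B) (n : Fin N) :
    Measurable (blockRate (K := K) c tx q i n) :=
  Measurable.iSup fun k => (((measurable_sinr c tx _ i).comp
    (measurable_userData n k)).const_mul _ |>.const_add _).log

lemma blockRate_nonneg (hq : ∀ i n, 0 ≤ q i n) (i : Fin B) (n : Fin N) (ω : Sample B K N) :
    0 ≤ blockRate c tx q i n ω :=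
  Real.iSup_nonneg fun k => Real.log_nonneg
    (by linarith [mul_nonneg (hq i n) (sinr_nonneg (c := c) (tx := tx) (fun j => hq j n) i (userData n ω k))])

/-- A crude bound from log(1+y) ≤ y and maximum ≤ sum. Being integrable and independent of the
powers, it serves for integrability and for dominated convergence. -/
lemma blockRate_le (hq : q ∈ powers c B N) (i : Fin B) (n : Fin N) (ω : Sample B K N) :
    blockRate c tx q i n ω ≤ ∑ k, c.Pcon * (c.σ * ‖ω.2 (i, k, n)‖ ^ 2) := by
  have hσ := c.σ_pos
  have hP := c.Pcon_pos
  refine Real.iSup_le (fun k => ?_) (Finset.sum_nonneg fun k _ => by positivity)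
  have h0 := sinr_nonneg (c := c) (tx := tx) (fun j => hq.1 j n) i (userData n ω k)
  calc _ ≤ q i n * sinr c tx (fun j => q j n) i (userData n ω k) := by
        have := Real.log_le_sub_one_of_pos (show 0 < 1 + q i n *
          sinr c tx (fun j => q j n) i (userData n ω k) by
            have := mul_nonneg (hq.1 i n) h0; linarith)
        linarith
    _ ≤ c.Pcon * (c.σ * ‖ω.2 (i, k, n)‖ ^ 2) :=
        mul_le_mul (powers_le hq i n) (sinr_le (fun j => hq.1 j n) i _) h0 hP.le
    _ ≤ _ := Finset.single_le_sum (f := fun k => c.Pcon * (c.σ * ‖ω.2 (i, k, n)‖ ^ 2))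
        (fun k _ => by positivity) (Finset.mem_univ k)

lemma integrable_norm_sq_fading (j : Fin B × Fin K × Fin N) :
    Integrable (fun ω : Sample B K N => ‖ω.2 j‖ ^ 2) (sampleLaw c B K N) :=
  (integrable_comp_eval (μ := fun _ : Fin B × Fin K × Fin N => complexNormal)
    (i := j) integrable_norm_sq_complexNormal).comp_snd _

lemma integrable_blockRate (hq : q ∈ powers c B N) (i : Fin B) (n : Fin N) :
    Integrable (blockRate (K := K) c tx q i n) (sampleLaw c B K N) := by
  refine Integrable.mono' (g := fun ω => ∑ k, c.Pcon * (c.σ * ‖ω.2 (i, k, n)‖ ^ 2)) ?_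
    (measurable_blockRate i n).aestronglyMeasurable (ae_of_all _ fun ω => ?_)
  · exact integrable_finsetSum _ fun k _ =>
      ((integrable_norm_sq_fading _).const_mul _).const_mul _
  · rw [Real.norm_of_nonneg (blockRate_nonneg hq.1 i n ω)]
    exact blockRate_le hq i n ω

lemma integrable_bestRate (hK : 0 < K) (hq : q ∈ powers c B N) :
    Integrable (bestRate c tx q) (sampleLaw c B K N) := by
  rw [funext (bestRate_eq (c := c) (tx := tx) (q := q) hK)]
  exact integrable_finsetSum _ fun i _ => integrable_finsetSum _ fun n _ =>
    integrable_blockRate hq i n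

lemma expectedRate_eq (hK : 0 < K) (hq : q ∈ powers c B N) :
    expectedRate c N K tx q = ∑ i, ∑ n, ∫ ω, blockRate (K := K) c tx q i n ω ∂sampleLaw c B K N := by
  rw [expectedRate, funext (bestRate_eq (c := c) (tx := tx) (q := q) hK),
    integral_finsetSum _ fun i _ => integrable_finsetSum _ fun n _ => integrable_blockRate hq i n]
  exact Finset.sum_congr rfl fun i _ => integral_finsetSum _ fun n _ => integrable_blockRate hq i n

lemma continuousOn_blockRate (hK : 0 < K) (i : Fin B) (n : Fin N) (ω : Sample B K N) :
    ContinuousOn (fun q => blockRate c tx q i n ω) (powers c B N) := by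
  have : Nonempty (Fin K) := ⟨⟨0, hK⟩⟩
  simp only [blockRate, ← Finset.sup'_univ_eq_ciSup]
  refine ContinuousOn.finset_sup'_apply _ fun k _ => ?_
  refine ContinuousOn.log ?_ fun q hq => ?_
  · refine continuousOn_const.add (ContinuousOn.mul (by fun_prop) ?_)
    unfold sinr
    refine ContinuousOn.div (by fun_prop) (by fun_prop) fun q hq => ?_
    have := sinr_denom_pos (c := c) (tx := tx) (fun j => hq.1 j n) i (userData n ω k)
    linarith
  · have := mul_nonneg (hq.1 i n)
      (sinr_nonneg (c := c) (tx := tx) (fun j => hq.1 j n) i (userData n ω k))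
    linarith

lemma continuousOn_expectedRate (hK : 0 < K) :
    ContinuousOn (expectedRate c N K tx) (powers c B N) := by
  unfold expectedRate
  refine continuousOn_of_dominated
    (bound := fun ω => ∑ i, ∑ n, ∑ k, c.Pcon * (c.σ * ‖ω.2 (i, k, n)‖ ^ 2))
    (fun q hq => (integrable_bestRate hK hq).aestronglyMeasurable)
    (fun q hq => ae_of_all _ fun ω => ?_)
    (integrable_finsetSum _ fun i _ => integrable_finsetSum _ fun n _ =>
      integrable_finsetSum _ fun k _ => ((integrable_norm_sq_fading _).const_mul _).const_mul _)
    (ae_of_all _ fun ω => ?_)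
  · rw [bestRate_eq hK, Real.norm_of_nonneg (Finset.sum_nonneg fun i _ =>
      Finset.sum_nonneg fun n _ => blockRate_nonneg hq.1 i n ω)]
    exact Finset.sum_le_sum fun i _ => Finset.sum_le_sum fun n _ => blockRate_le hq i n ω
  · simp only [bestRate_eq hK]
    exact continuousOn_finsetSum _ fun i _ => continuousOn_finsetSum _ fun n _ =>
      continuousOn_blockRate hK i n ω

lemma isGreatest_CLB (hK : 0 < K) :
    IsGreatest (expectedRate c N K tx '' powers c B N) (CLB c N K tx) :=
  ((isCompact_powers c B N).image_of_continuousOn (continuousOn_expectedRate hK)).isGreatest_sSup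
    (Set.Nonempty.image _ ⟨0, zero_mem_powers c B N⟩)

lemma measurableSet_sinr_gt (tx : Fin B → Plane) (q : Fin B → ℝ) (i : Fin B) (x : ℝ) :
    MeasurableSet {y | x < sinr c tx q i y} :=
  measurableSet_lt measurable_const (measurable_sinr c tx q i)

lemma sampleLaw_forall_sinr_le (q : Fin B → ℝ) (i : Fin B) (n : Fin N) (x : ℝ) :
    (sampleLaw c B K N).real {ω | ∀ k, sinr c tx q i (userData n ω k) ≤ x} =
      (1 - (userLaw c B).real {y | x < sinr c tx q i y}) ^ K := by
  have h := sampleLaw_forall_user c B K N n (measurableSet_sinr_gt (c := c) tx q i x).compl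
  rw [← probReal_compl_eq_one_sub (measurableSet_sinr_gt tx q i x), measureReal_def, measureReal_def,
    ← ENNReal.toReal_pow, ← h]
  simp [userData, Set.compl_ofPred]

lemma sampleLaw_exists_sinr_gt (q : Fin B → ℝ) (i : Fin B) (n : Fin N) (x : ℝ) :
    (sampleLaw c B K N).real {ω | ∃ k, x < sinr c tx q i (userData n ω k)} =
      1 - (1 - (userLaw c B).real {y | x < sinr c tx q i y}) ^ K := by
  have hm : MeasurableSet {ω : Sample B K N | ∀ k, sinr c tx q i (userData n ω k) ≤ x} := by
    simp only [Set.ofPred_forall]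
    exact MeasurableSet.iInter fun k => measurableSet_le
      ((measurable_sinr c tx _ i).comp (measurable_userData n k)) measurable_const
  rw [← sampleLaw_forall_sinr_le (N := N) q i n x, ← probReal_compl_eq_one_sub hm]
  congr 1; ext ω; simp

/-- A lower bound for the expected rate on one resource block. -/
lemma mul_log_le_integral_blockRate (htx : ∀ i, ‖tx i‖ ≤ c.p - c.R) {t : ℝ} (ht : 1 ≤ t)
    {z : (Fin B → Fin N → ℝ) × (Fin B → Fin N → ℝ)} (hz : z ∈ opFeasible c B N c.r₀ t)
    (i : Fin B) (n : Fin N) :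
    (1 - (1 - 1 / t) ^ K) * Real.log (1 + z.1 i n * z.2 i n) ≤
      ∫ ω, blockRate (K := K) c tx z.1 i n ω ∂sampleLaw c B K N := by
  set x := z.2 i n with hx
  obtain ⟨hx0, hxt⟩ := (mem_opFeasible.1 hz).2 i n
  have hq := hz.1
  have hlog : 0 ≤ Real.log (1 + z.1 i n * x) :=
    Real.log_nonneg (by linarith [opFeasible_nonneg hz i n])
  set A : Set (Sample B K N) := {ω | ∃ k, x < sinr c tx (fun j => z.1 j n) i (userData n ω k)} with hA
  have hAm : MeasurableSet A := by
    simp only [hA, Set.ofPred_exists]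
    exact MeasurableSet.iUnion fun k => measurableSet_lt measurable_const
      ((measurable_sinr c tx _ i).comp (measurable_userData n k))
  -- For d = r₀ the loss is one, so the constraint says that the lower tail bound at x is exactly
  -- 1/t.
  have h1 : 1 / t ≤ (userLaw c B).real {y | x < sinr c tx (fun j => z.1 j n) i y} := by
    have h := ofReal_le_userLaw_sinr_gt c tx (fun j => hq.1 j n) i (htx i) hx0
    simp only [c.loss_r₀, div_one, ← hx] at hxt
    have h2 : c.ρ / (c.ρ * t) = 1 / t := by
      have := c.ρ_pos; field_simp
    rw [hxt, h2] at h
    rwa [measureReal_def, ← ENNReal.ofReal_le_iff_le_toReal (measure_ne_top _ _)]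
  have h2 : 1 - (1 - 1 / t) ^ K ≤ (sampleLaw c B K N).real A := by
    rw [hA, sampleLaw_exists_sinr_gt]
    have : (userLaw c B).real {y | x < sinr c tx (fun j => z.1 j n) i y} ≤ 1 := measureReal_le_one
    gcongr
  calc _ ≤ (sampleLaw c B K N).real A * Real.log (1 + z.1 i n * x) :=
        mul_le_mul_of_nonneg_right h2 hlog
    _ = ∫ ω, A.indicator (fun _ => Real.log (1 + z.1 i n * x)) ω ∂sampleLaw c B K N := by
        rw [integral_indicator_const _ hAm, smul_eq_mul]
    _ ≤ _ := by
        refine integral_mono ((integrable_const _).indicator hAm) (integrable_blockRate hq i n)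
          fun ω => ?_
        by_cases hω : ω ∈ A
        · rw [Set.indicator_of_mem hω]
          obtain ⟨k, hk⟩ := hω
          refine le_trans (Real.log_le_log ?_ ?_) (le_ciSup (f := fun k : Fin K => Real.log
            (1 + z.1 i n * sinr c tx (fun j => z.1 j n) i (userData n ω k)))
            (Set.finite_range _).bddAbove k)
          · linarith [opFeasible_nonneg hz i n]
          · have := mul_le_mul_of_nonneg_left hk.le (hq.1 i n)
            linarith
        · rw [Set.indicator_of_notMem hω]
          exact blockRate_nonneg hq.1 i n ω

/-- Optimal powers of OP are admissible in the stochastic problem. -/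
lemma mul_OP_le_CLB (hK : 0 < K) (htx : ∀ i, ‖tx i‖ ≤ c.p - c.R) {t : ℝ} (ht : 1 ≤ t)
    (hρt : 1 ≤ c.ρ * t) :
    (1 - (1 - 1 / t) ^ K) * OP c B N c.r₀ t ≤ CLB c N K tx := by
  obtain ⟨z, hz, h⟩ := (isGreatest_OP (B := B) (N := N) c.r₀_pos hρt).1
  rw [← h]
  refine le_trans ?_ ((isGreatest_CLB hK).2 ⟨z.1, hz.1, rfl⟩)
  rw [expectedRate_eq hK hz.1, opObjective, Finset.mul_sum]
  refine Finset.sum_le_sum fun i _ => ?_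
  rw [Finset.mul_sum]
  exact Finset.sum_le_sum fun n _ => mul_log_le_integral_blockRate htx ht hz i n

lemma one_sub_exp_mul_OP_le_CLB (hK : 0 < K) (htx : ∀ i, ‖tx i‖ ≤ c.p - c.R) {t : ℝ}
    (ht : 1 ≤ t) (hρt : 1 ≤ c.ρ * t) :
    (1 - Real.exp (-(K / t))) * OP c B N c.r₀ t ≤ CLB c N K tx := by
  refine le_trans (mul_le_mul_of_nonneg_right ?_ (OP_nonneg c.r₀_pos hρt))
    (mul_OP_le_CLB hK htx ht hρt)
  have h1 : 1 - 1 / t ≤ Real.exp (-(1 / t)) := by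
    have := Real.add_one_le_exp (-(1 / t)); linarith
  have h2 : (1 - 1 / t) ^ K ≤ Real.exp (-(1 / t)) ^ K := by
    refine pow_le_pow_left₀ ?_ h1 K
    have : 1 / t ≤ 1 := (div_le_one (by linarith)).2 ht
    linarith
  rw [← Real.exp_nat_mul, mul_neg, mul_one_div] at h2
  linarith

end

/-! ### The expected maximum: harmonic numbers and the Gumbel correction -/

lemma integral_abs_mul_exp_neg_abs {σ : ℝ} (hσ : 0 < σ) :
    ∫ v : ℝ, |v| * Real.exp (-(|v| / σ)) = 2 * σ ^ 2 := by
  have h1 := Real.integral_rpow_mul_exp_neg_mul_Ioi (a := 2) (r := 1 / σ) two_pos (by positivity)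
  have h2 := integral_comp_abs (f := fun v => v * Real.exp (-(v / σ)))
  rw [h2]
  have h3 : ∀ t : ℝ, t ^ ((2 : ℝ) - 1) * Real.exp (-(1 / σ * t)) = t * Real.exp (-(t / σ)) := by
    intro t
    rw [show (2 : ℝ) - 1 = 1 by norm_num, Real.rpow_one]
    congr 3; ring
  simp_rw [h3] at h1
  rw [h1, Real.Gamma_two, one_div_one_div]
  norm_num

lemma integrable_abs_mul_exp_neg_abs {σ : ℝ} (hσ : 0 < σ) :
    Integrable fun v : ℝ => |v| * Real.exp (-(|v| / σ)) := by
  -- A non-integrable function has integral 0 by convention, but this integral is positive.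
  by_contra h
  have := integral_undef h
  rw [integral_abs_mul_exp_neg_abs hσ] at this
  have : 0 < 2 * σ ^ 2 := by positivity
  linarith

lemma sum_range_one_div_le {K : ℕ} (hK : 0 < K) :
    ∑ j ∈ Finset.range K, (1 : ℝ) / (j + 1) ≤
      Real.eulerMascheroniConstant + Real.log K + 1 / K := by
  have h1 := Real.eulerMascheroniSeq_lt_eulerMascheroniConstant K
  have hK' : (0 : ℝ) < K := by exact_mod_cast hK
  have h2 : Real.log (K + 1) ≤ Real.log K + 1 / K := by
    have h3 : (K + 1 : ℝ) = K * (1 + 1 / K) := by field_simp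
    rw [h3, Real.log_mul hK'.ne' (by positivity)]
    have := Real.log_le_sub_one_of_pos (show (0 : ℝ) < 1 + 1 / K by positivity)
    linarith
  have h4 : ((harmonic K : ℚ) : ℝ) = ∑ j ∈ Finset.range K, (1 : ℝ) / (j + 1) := by
    simp [harmonic]
  rw [Real.eulerMascheroniSeq, h4] at h1
  linarith

/-- In the series of -log(1 - r), the terms after the first K are at most r^K times the whole
series, because the denominators only grow. -/
lemma mul_neg_log_le_sum {r : ℝ} (h0 : 0 ≤ r) (h1 : r < 1) (K : ℕ) :
    (1 - r ^ K) * -Real.log (1 - r) ≤ ∑ j ∈ Finset.range K, r ^ (j + 1) / ((j : ℝ) + 1) := by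
  have hs := Real.hasSum_pow_div_log_of_abs_lt_one (x := r) (by rwa [abs_of_nonneg h0])
  have h2 := hs.summable.sum_add_tsum_nat_add K
  rw [hs.tsum_eq] at h2
  have h3 : ∑' j, r ^ (j + K + 1) / (((j + K : ℕ) : ℝ) + 1) ≤ r ^ K * -Real.log (1 - r) := by
    rw [← hs.tsum_eq, ← tsum_mul_left]
    refine Summable.tsum_le_tsum (fun j => ?_)
      ((summable_nat_add_iff K).2 hs.summable) (hs.summable.mul_left _)
    rw [show j + K + 1 = K + (j + 1) by ring, pow_add, mul_div_assoc]
    gcongr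
    simp
  linarith

section Gumbel

variable {ι : Type*} {σ : ℝ} {s : Finset ι} {a : ι → ℝ}

/-- The logarithmic derivative of `∏ⱼ (1 + aⱼ x)`. -/
noncomputable def slope (s : Finset ι) (a : ι → ℝ) (x : ℝ) : ℝ := ∑ j ∈ s, a j / (1 + a j * x)

lemma slope_nonneg (ha : ∀ j, 0 ≤ a j) {x : ℝ} (hx : 0 ≤ x) : 0 ≤ slope s a x :=
  Finset.sum_nonneg fun j _ => by have := ha j; positivity

/-- As a/(1 + az) ≤ 1/z whatever the size of a, the Lipschitz constant depends on the number of
factors but not on the powers. -/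
lemma abs_slope_sub_le (ha : ∀ j, 0 ≤ a j) {x y : ℝ} (hy : 0 < y) (hx : y / 2 ≤ x) :
    |slope s a x - slope s a y| ≤ 2 * s.card / y ^ 2 * |x - y| := by
  have hx0 : 0 < x := by linarith
  rw [slope, slope, ← Finset.sum_sub_distrib]
  refine (Finset.abs_sum_le_sum_abs _ _).trans ?_
  have : ∀ j ∈ s, |a j / (1 + a j * x) - a j / (1 + a j * y)| ≤ 2 / y ^ 2 * |x - y| := by
    intro j _
    have hj := ha j
    have h1 : a j / (1 + a j * x) - a j / (1 + a j * y) =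
        (a j / (1 + a j * x)) * (a j / (1 + a j * y)) * (y - x) := by
      field_simp; ring
    have h2 : ∀ z : ℝ, 0 < z → a j / (1 + a j * z) ≤ 1 / z := fun z hz => by
      rw [div_le_div_iff₀ (by positivity) hz]; linarith
    rw [h1, abs_mul, abs_sub_comm y x, abs_of_nonneg (by positivity)]
    refine mul_le_mul_of_nonneg_right ?_ (abs_nonneg _)
    calc _ ≤ 1 / x * (1 / y) := mul_le_mul (h2 x hx0) (h2 y hy) (by positivity) (by positivity)
      _ ≤ 1 / (y / 2) * (1 / y) := by gcongr
      _ = 2 / y ^ 2 := by field_simp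
  refine (Finset.sum_le_card_nsmul s _ _ this).trans (le_of_eq ?_)
  rw [nsmul_eq_mul]; ring

lemma hasDerivAt_log_prod (ha : ∀ j, 0 ≤ a j) {x : ℝ} (hx : 0 ≤ x) :
    HasDerivAt (fun x => ∑ j ∈ s, Real.log (1 + a j * x)) (slope s a x) x := by
  unfold slope
  refine HasDerivAt.fun_sum fun j _ => ?_
  have h : 1 + a j * x ≠ 0 := by have := ha j; positivity
  simpa using (((hasDerivAt_id x).const_mul (a j)).const_add 1).log h

lemma growth_eq_exp (ha : ∀ j, 0 ≤ a j) {x : ℝ} (hx : 0 ≤ x) :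
    growth σ s a x = Real.exp (x / σ + ∑ j ∈ s, Real.log (1 + a j * x)) := by
  rw [growth, Real.exp_add, Real.exp_sum]
  congr 1
  exact Finset.prod_congr rfl fun j _ => (Real.exp_log (by have := ha j; positivity)).symm

lemma hasDerivAt_growth (ha : ∀ j, 0 ≤ a j) {x : ℝ} (hx : 0 < x) :
    HasDerivAt (growth σ s a) (growth σ s a x * (1 / σ + slope s a x)) x := by
  rw [growth_eq_exp ha hx.le]
  refine HasDerivAt.congr_of_eventuallyEq
    (((hasDerivAt_id x).div_const σ).add (hasDerivAt_log_prod ha hx.le)).exp ?_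
  filter_upwards [lt_mem_nhds hx] with y hy
  exact growth_eq_exp ha hy.le

/-- The geometric sum collapses: the tail of a maximum of K variables, weighted by the hazard rate g
of a single one, has an explicit antiderivative. Its value at T = 0 is the K-th harmonic number, the
source of the Euler–Mascheroni constant. -/
lemma hasDerivAt_harmonic_polynomial (K : ℕ) {T : ℝ → ℝ} {x g : ℝ}
    (hT : HasDerivAt T (-(T x * g)) x) :
    HasDerivAt (fun x => ∑ j ∈ Finset.range K, (1 - T x) ^ (j + 1) / ((j : ℝ) + 1))
      ((1 - (1 - T x) ^ K) * g) x := by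
  have h1 : ∀ j ∈ Finset.range K, HasDerivAt (fun x => (1 - T x) ^ (j + 1) / ((j : ℝ) + 1))
      ((1 - T x) ^ j * (T x * g)) x := by
    intro j _
    refine (((hT.const_sub 1).pow (j + 1)).div_const ((j : ℝ) + 1)).congr_deriv ?_
    have : (j : ℝ) + 1 ≠ 0 := by positivity
    push_cast
    field_simp
  refine (HasDerivAt.fun_sum h1).congr_deriv ?_
  rw [← Finset.sum_mul, ← mul_assoc]
  congr 1
  have := geom_sum_mul (1 - T x) K
  linear_combination -this

variable (hσ : 0 < σ) (ha : ∀ j, 0 ≤ a j)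
include hσ ha

lemma integral_mul_log_deriv {K : ℕ} {κ b : ℝ} (hκ : 0 < κ) (hb : 0 < b)
    (hbκ : κ ≤ growth σ s a b) :
    IntegrableOn (fun x => (1 - (1 - κ / growth σ s a x) ^ K) * (1 / σ + slope s a x)) (Set.Ioi b) ∧
    ∫ x in Set.Ioi b, (1 - (1 - κ / growth σ s a x) ^ K) * (1 / σ + slope s a x) =
      ∑ j ∈ Finset.range K, (1 : ℝ) / (j + 1) -
        ∑ j ∈ Finset.range K, (1 - κ / growth σ s a b) ^ (j + 1) / ((j : ℝ) + 1) := by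
  have hd : ∀ x ∈ Set.Ici b, HasDerivAt
      (fun x => ∑ j ∈ Finset.range K, (1 - κ / growth σ s a x) ^ (j + 1) / ((j : ℝ) + 1))
      ((1 - (1 - κ / growth σ s a x) ^ K) * (1 / σ + slope s a x)) x := by
    intro x hx
    have hx0 : 0 < x := hb.trans_le hx
    have hg := growth_pos (σ := σ) (s := s) ha hx0.le
    refine hasDerivAt_harmonic_polynomial K ?_
    refine (((hasDerivAt_growth (σ := σ) (s := s) ha hx0).fun_inv hg.ne').const_mul κ).congr_deriv ?_
    field_simp
  have hnn : ∀ x ∈ Set.Ioi b, 0 ≤ (1 - (1 - κ / growth σ s a x) ^ K) * (1 / σ + slope s a x) := by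
    intro x hx
    have hx0 : 0 < x := hb.trans hx
    have hg := growth_pos (σ := σ) (s := s) ha hx0.le
    have hle : κ / growth σ s a x ≤ 1 :=
      (div_le_one hg).2 (hbκ.trans (growth_lt hσ ha hb.le hx).le)
    have h0 : 0 < κ / growth σ s a x := by positivity
    have := slope_nonneg (s := s) ha hx0.le
    refine mul_nonneg ?_ (by positivity)
    linarith [pow_le_one₀ (n := K) (sub_nonneg.2 hle) (by linarith)]
  have ht : Tendsto (fun x => ∑ j ∈ Finset.range K,
      (1 - κ / growth σ s a x) ^ (j + 1) / ((j : ℝ) + 1)) atTop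
      (nhds (∑ j ∈ Finset.range K, (1 : ℝ) / (j + 1))) := by
    refine tendsto_finsetSum _ fun j _ => Tendsto.div_const ?_ _
    have h1 : Tendsto (growth σ s a) atTop atTop := by
      refine tendsto_atTop_mono' _ ?_
        (Real.tendsto_exp_atTop.comp (tendsto_id.atTop_div_const hσ))
      filter_upwards [eventually_ge_atTop 0] with x hx
      exact exp_le_growth ha hx
    have h2 := ((h1.const_div_atTop κ).const_sub 1).pow (j + 1)
    simpa using h2
  exact ⟨integrableOn_Ioi_deriv_of_nonneg' hd hnn ht,
    integral_Ioi_of_hasDerivAt_of_nonneg' hd hnn ht⟩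

/-- The expected maximum of `K` independent variables with tail `κ / growth` exceeds the
`1 / K`-quantile `y` by asymptotically at most the mean of a Gumbel variable of scale `σ`. -/
lemma integral_tail_max_le {K : ℕ} (hK : 0 < K) {ρ y : ℝ} (hρ : 0 < ρ) (hρ1 : ρ ≤ 1)
    (hy : 2 * σ ≤ y) (hyK : growth σ s a y = ρ * K) :
    IntegrableOn (fun x => 1 - (1 - ρ * (1 + 2 * σ / y) / growth σ s a x) ^ K) (Set.Ioi (y / 2)) ∧
    ∫ x in Set.Ioi (y / 2), (1 - (1 - ρ * (1 + 2 * σ / y) / growth σ s a x) ^ K) ≤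
      y / 2 + σ * (Real.eulerMascheroniConstant + (1 / K + 2 * σ / y +
        Real.log K * Real.exp (-Real.exp (y / (2 * σ))) + 8 * σ ^ 2 * s.card / y ^ 2)) := by
  have hy0 : 0 < y := by linarith
  have hK' : (0 : ℝ) < K := by exact_mod_cast hK
  have hη : 2 * σ / y ≤ 1 := (div_le_one hy0).2 hy
  have hη0 : 0 < 2 * σ / y := by positivity
  set η := 2 * σ / y with hηdef
  set κ := ρ * (1 + η) with hκdef
  have hκ : 0 < κ := by positivity
  -- From y/2 on, the slope has Lipschitz constant of order |s|/y², and a factor 1 + σ/x is at most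
  -- 1 + 2σ/y.
  set b := y / 2 with hb
  have hb0 : 0 < b := by positivity
  set G := growth σ s a with hG
  have hGpos : ∀ x, 0 ≤ x → 0 < G x := fun x hx => growth_pos ha hx
  have hGb : κ ≤ G b := by
    have h1 : Real.exp (b / σ) ≤ G b := exp_le_growth ha hb0.le
    have h2 := Real.add_one_le_exp (b / σ)
    have h3 : 1 ≤ b / σ := by rw [one_le_div hσ, hb]; linarith
    have h4 : κ ≤ 1 * 2 := mul_le_mul hρ1 (by linarith) (by positivity) zero_le_one
    linarith
  have hT : ∀ x, b ≤ x → 0 ≤ κ / G x ∧ κ / G x ≤ 1 := fun x hx => by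
    have hx0 := hGpos x (hb0.le.trans hx)
    refine ⟨by positivity, (div_le_one hx0).2 (hGb.trans ?_)⟩
    rcases hx.eq_or_lt with rfl | h
    · exact le_rfl
    · exact (growth_lt hσ ha hb0.le h).le
  set Φ : ℝ → ℝ := fun x => 1 - (1 - κ / G x) ^ K with hΦ
  set W := slope s a y with hW
  have hW0 : 0 ≤ W := slope_nonneg ha hy0.le
  have hΦ01 : ∀ x, b ≤ x → 0 ≤ Φ x ∧ Φ x ≤ 1 := fun x hx => by
    obtain ⟨h0, h1⟩ := hT x hx
    have h2 := pow_le_one₀ (n := K) (sub_nonneg.2 h1) (by linarith)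
    have h3 := pow_nonneg (sub_nonneg.2 h1) K
    simp only [hΦ]; constructor <;> linarith
  have hΦle : ∀ x, b ≤ x → Φ x ≤ K * (κ / G x) := fun x hx => by
    obtain ⟨h0, h1⟩ := hT x hx
    have := one_add_mul_le_pow (a := -(κ / G x)) (by linarith) K
    simp only [hΦ]
    rw [← sub_eq_add_neg] at this
    linarith
  have hcompl : ∀ x, b ≤ x → 1 - Φ x ≤ Real.exp (-(K * (κ / G x))) := fun x hx => by
    obtain ⟨h0, h1⟩ := hT x hx
    have h2 := Real.add_one_le_exp (-(κ / G x))
    have h3 := pow_le_pow_left₀ (sub_nonneg.2 h1) (show 1 - κ / G x ≤ Real.exp (-(κ / G x)) by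
      linarith) K
    rw [← Real.exp_nat_mul] at h3
    simp only [hΦ, sub_sub_cancel]
    rwa [mul_neg] at h3
  have hKT : ∀ x, K * (κ / G x) = (1 + η) * (G y / G x) := fun x => by
    rw [hyK, hκdef]; ring
  -- Gumbel profile: Φ approaches 1 doubly exponentially to the left of y and, by the next bound,
  -- decays exponentially to its right.
  have hlow : ∀ x, b ≤ x → x ≤ y → 1 - Φ x ≤ Real.exp (-Real.exp ((y - x) / σ)) := by
    intro x hx hxy
    refine (hcompl x hx).trans (Real.exp_le_exp.2 (neg_le_neg ?_))
    have hx0 := hGpos x (hb0.le.trans hx)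
    have h1 : Real.exp ((y - x) / σ) ≤ G y / G x := by
      rw [le_div_iff₀ hx0]; exact exp_mul_growth_le ha (hb0.le.trans hx) hxy
    rw [hKT]
    have : 0 ≤ G y / G x := (Real.exp_pos _).le.trans h1
    nlinarith
  have hhigh : ∀ x, y ≤ x → Φ x ≤ 2 * Real.exp (-((x - y) / σ)) := by
    intro x hx
    have hx0 := hGpos x (hy0.le.trans hx)
    refine (hΦle x (by linarith)).trans ?_
    rw [hKT]
    have h1 : G y / G x ≤ Real.exp (-((x - y) / σ)) := by
      rw [div_le_iff₀ hx0, Real.exp_neg, inv_mul_eq_div, le_div_iff₀' (Real.exp_pos _)]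
      exact exp_mul_growth_le ha hy0.le hx
    have : 0 < G y / G x := div_pos (hGpos y hy0.le) hx0
    have := Real.exp_pos (-((x - y) / σ))
    nlinarith
  have hcont : ContinuousOn Φ (Set.Ici b) := by
    refine continuousOn_const.sub ((continuousOn_const.sub
      (continuousOn_const.div continuous_growth.continuousOn fun x hx => ?_)).pow K)
    exact (hGpos x (hb0.le.trans hx)).ne'
  have hΦmeas : AEStronglyMeasurable Φ (volume.restrict (Set.Ioi b)) :=
    (hcont.mono Set.Ioi_subset_Ici_self).aestronglyMeasurable measurableSet_Ioi
  have hΦint : IntegrableOn Φ (Set.Ioi b) := by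
    refine Integrable.mono' (g := fun x => K * κ * Real.exp (-(1 / σ) * x))
      ((integrableOn_exp_mul_Ioi (by simp [hσ]) b).const_mul _) hΦmeas
      ((ae_restrict_iff' measurableSet_Ioi).2 (ae_of_all _ fun x hx => ?_))
    have hx : b < x := hx
    rw [Real.norm_of_nonneg (hΦ01 x hx.le).1]
    refine (hΦle x hx.le).trans ?_
    rw [mul_assoc, div_eq_mul_inv]
    have h1 : Real.exp (x / σ) ≤ G x := exp_le_growth ha (hb0.le.trans hx.le)
    have h2 : (G x)⁻¹ ≤ Real.exp (-(1 / σ) * x) := by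
      rw [show -(1 / σ) * x = -(x / σ) by ring, Real.exp_neg]
      exact inv_anti₀ (Real.exp_pos _) h1
    gcongr
  obtain ⟨hI1, hI2⟩ := integral_mul_log_deriv (K := K) hσ ha hκ hb0 hGb
  have hI3 : IntegrableOn (fun x => Φ x * (slope s a x - W)) (Set.Ioi b) := by
    refine (hI1.sub (hΦint.mul_const (1 / σ + W))).congr (ae_of_all _ fun x => ?_)
    simp only [Pi.sub_apply, hΦ]; ring
  have hI4 : IntegrableOn (fun x => slope s a x - W) (Set.Ioc b y) := by
    have : ContinuousOn (fun x => slope s a x - W) (Set.Icc b y) := by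
      unfold slope
      refine ContinuousOn.sub (continuousOn_finsetSum _ fun j _ => ?_) continuousOn_const
      refine continuousOn_const.div (by fun_prop) fun x hx => ?_
      have := ha j; have := hb0.le.trans hx.1; positivity
    exact this.integrableOn_Icc.mono_set Set.Ioc_subset_Icc_self
  have hI5 : ∫ x in Set.Ioc b y, (slope s a x - W) =
      (∑ j ∈ s, Real.log (1 + a j * y) - ∑ j ∈ s, Real.log (1 + a j * b)) - W * (y - b) := by
    have hby : b ≤ y := by linarith
    rw [← intervalIntegral.integral_of_le hby]
    rw [intervalIntegral.integral_eq_sub_of_hasDerivAt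
      (f := fun x => ∑ j ∈ s, Real.log (1 + a j * x) - W * x)]
    · ring
    · intro x hx
      rw [Set.uIcc_of_le hby] at hx
      simpa using (hasDerivAt_log_prod (s := s) ha (hb0.le.trans hx.1)).fun_sub
        ((hasDerivAt_id x).const_mul W)
    · rwa [intervalIntegrable_iff_integrableOn_Ioc_of_le hby]
  -- comparison of the profile of the maximum with a step function
  have hcmp : (∫ x in Set.Ioc b y, (slope s a x - W)) - ∫ x in Set.Ioi b, Φ x * (slope s a x - W) ≤
      8 * σ ^ 2 * s.card / y ^ 2 := by
    have hby : b ≤ y := by linarith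
    have hI4' : IntegrableOn ((Set.Iic y).indicator fun x => slope s a x - W) (Set.Ioi b) := by
      rw [integrableOn_indicator_iff measurableSet_Iic, Set.inter_comm, Set.Ioi_inter_Iic]
      exact hI4
    have hE := ((integrable_abs_mul_exp_neg_abs hσ).comp_sub_right y).const_mul
      (4 * s.card / y ^ 2)
    have hEnn : ∀ x : ℝ, 0 ≤ 4 * s.card / y ^ 2 * (|x - y| * Real.exp (-(|x - y| / σ))) :=
      fun x => by positivity
    rw [← Set.Ioi_inter_Iic, ← setIntegral_indicator measurableSet_Iic, ← integral_sub hI4' hI3]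
    calc _ ≤ ∫ x in Set.Ioi b, 4 * s.card / y ^ 2 * (|x - y| * Real.exp (-(|x - y| / σ))) := by
          refine setIntegral_mono_on (hI4'.sub hI3) hE.integrableOn measurableSet_Ioi fun x hx => ?_
          have hx : b < x := hx
          have hs1 := abs_slope_sub_le (s := s) ha hy0 hx.le
          obtain ⟨hΦ0, hΦ1⟩ := hΦ01 x hx.le
          -- The first factor bounds the distance of Φ from the step function, the second the change
          -- of the slope. As |v| e^{-|v|/σ} integrates to 2σ², the total is 8σ²|s|/y².
          have hs2 : 4 * s.card / y ^ 2 * (|x - y| * Real.exp (-(|x - y| / σ))) =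
            (2 * Real.exp (-(|x - y| / σ))) * (2 * s.card / y ^ 2 * |x - y|) := by ring
          rw [hs2]
          by_cases hxy : x ≤ y
          · rw [Set.indicator_of_mem (show x ∈ Set.Iic y from hxy), ← one_sub_mul]
            have h1 : 1 - Φ x ≤ 2 * Real.exp (-(|x - y| / σ)) := by
              refine (hlow x hx.le hxy).trans ?_
              rw [abs_sub_comm, abs_of_nonneg (sub_nonneg.2 hxy)]
              have h2 : Real.exp (-Real.exp ((y - x) / σ)) ≤ Real.exp (-((y - x) / σ)) :=
                Real.exp_le_exp.2 (by linarith [Real.add_one_le_exp ((y - x) / σ)])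
              linarith [Real.exp_pos (-((y - x) / σ))]
            calc _ ≤ (1 - Φ x) * |slope s a x - W| :=
                  mul_le_mul_of_nonneg_left (le_abs_self _) (by linarith)
              _ ≤ _ := mul_le_mul h1 hs1 (abs_nonneg _) (by positivity)
          · rw [Set.indicator_of_notMem (show x ∉ Set.Iic y from hxy), zero_sub, ← mul_neg]
            push Not at hxy
            have h1 := hhigh x hxy.le
            rw [← abs_of_pos (sub_pos.2 hxy)] at h1
            calc _ ≤ Φ x * |slope s a x - W| :=
                  mul_le_mul_of_nonneg_left (neg_le_abs _) hΦ0
              _ ≤ _ := mul_le_mul h1 hs1 (abs_nonneg _) (by positivity)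
      _ ≤ ∫ x, 4 * s.card / y ^ 2 * (|x - y| * Real.exp (-(|x - y| / σ))) :=
          setIntegral_le_integral hE (ae_of_all _ hEnn)
      _ = _ := by
          rw [integral_const_mul,
            integral_sub_right_eq_self (fun x : ℝ => |x| * Real.exp (-(|x| / σ))) y,
            integral_abs_mul_exp_neg_abs hσ]
          ring
  refine ⟨hΦint, ?_⟩
  -- Freezing the hazard rate at y extracts the integral of Φ from the explicit weighted integral,
  -- up to the error just bounded.
  have hJ : (1 / σ + W) * ∫ x in Set.Ioi b, Φ x =
      (∫ x in Set.Ioi b, Φ x * (1 / σ + slope s a x)) -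
        ∫ x in Set.Ioi b, Φ x * (slope s a x - W) := by
    rw [← integral_sub hI1 hI3, ← integral_const_mul]
    congr 1; ext x; ring
  have hlogG : ∀ x, 0 ≤ x → Real.log (G x) = x / σ + ∑ j ∈ s, Real.log (1 + a j * x) :=
    fun x hx => by rw [hG, growth_eq_exp ha hx, Real.log_exp]
  have hlogy : y / σ + ∑ j ∈ s, Real.log (1 + a j * y) = Real.log ρ + Real.log K := by
    rw [← hlogG y hy0.le, hyK, Real.log_mul hρ.ne' hK'.ne']
  have hlogκ : Real.log κ ≤ Real.log ρ + η := by
    rw [hκdef, Real.log_mul hρ.ne' (by positivity)]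
    have := Real.log_le_sub_one_of_pos (show 0 < 1 + η by positivity)
    linarith
  have hlogκ' : Real.log ρ ≤ Real.log κ := Real.log_le_log hρ (by nlinarith)
  have hGby : Real.log (G b) ≤ Real.log (G y) :=
    Real.log_le_log (hGpos b hb0.le) (growth_lt hσ ha hb0.le (by linarith)).le
  have hH := sum_range_one_div_le hK
  have hTb : 0 < κ / G b := div_pos hκ (hGpos b hb0.le)
  -- The harmonic polynomial at `b` is at least (1 - (1 - κ/G b)^K) · log(G b/κ); the missing part
  -- is the doubly exponentially small term of `htiny`.
  have hQ := mul_neg_log_le_sum (sub_nonneg.2 (hT b le_rfl).2) (by linarith) K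
  rw [sub_sub_cancel, Real.log_div hκ.ne' (hGpos b hb0.le).ne', neg_sub] at hQ
  have htiny : (1 - κ / G b) ^ K * (Real.log (G b) - Real.log κ) ≤
      Real.log K * Real.exp (-Real.exp (y / (2 * σ))) := by
    have h1 := hlow b le_rfl (by linarith)
    simp only [hΦ, sub_sub_cancel] at h1
    rw [show (y - b) / σ = y / (2 * σ) by rw [hb]; field_simp; ring] at h1
    have h2 : Real.log (G b) - Real.log κ ≤ Real.log K := by
      rw [hlogG y hy0.le, hlogy] at hGby; linarith
    have h3 : 0 ≤ Real.log (G b) - Real.log κ := sub_nonneg.2 (Real.log_le_log hκ hGb)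
    rw [mul_comm]
    exact mul_le_mul h2 h1 (pow_nonneg (sub_nonneg.2 (hT b le_rfl).2) K) (h3.trans h2)
  -- The logarithms cancel: 1/σ + slope integrates over [b, y] to log G(y) - log G(b), and log G(y)
  -- = log ρ + log K.
  have hmain : (1 / σ + W) * ((∫ x in Set.Ioi b, Φ x) - (y - b)) ≤
      Real.eulerMascheroniConstant + (1 / K + η +
        Real.log K * Real.exp (-Real.exp (y / (2 * σ))) + 8 * σ ^ 2 * s.card / y ^ 2) := by
    have hyb : (y - b) / σ = y / σ - b / σ := sub_div _ _ _
    have e1 : (1 / σ + W) * ((∫ x in Set.Ioi b, Φ x) - (y - b)) =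
        (1 / σ + W) * (∫ x in Set.Ioi b, Φ x) - ((y - b) / σ + W * (y - b)) := by ring
    rw [e1, hJ, hyb]
    rw [hI5] at hcmp
    have e2 := hlogG b hb0.le
    simp only [hΦ] at hcmp ⊢
    rw [hI2]
    linarith
  have hR : 0 ≤ Real.eulerMascheroniConstant + (1 / K + η +
        Real.log K * Real.exp (-Real.exp (y / (2 * σ))) + 8 * σ ^ 2 * s.card / y ^ 2) := by
    have := Real.one_half_lt_eulerMascheroniConstant
    have := Real.log_natCast_nonneg K
    positivity
  have hfin : (∫ x in Set.Ioi b, Φ x) - (y - b) ≤ σ * (Real.eulerMascheroniConstant + (1 / K + η +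
        Real.log K * Real.exp (-Real.exp (y / (2 * σ))) + 8 * σ ^ 2 * s.card / y ^ 2)) := by
    -- Dropping W ≥ 0 is legitimate only for a positive excess; otherwise the bound is trivial.
    rcases le_or_gt ((∫ x in Set.Ioi b, Φ x) - (y - b)) 0 with h | h
    · exact h.trans (mul_nonneg hσ.le hR)
    · rw [← div_le_iff₀' hσ]
      refine le_trans ?_ hmain
      rw [div_eq_inv_mul, ← one_div]
      exact mul_le_mul_of_nonneg_right (by linarith) h.le
  have hyb : y - b = b := by rw [hb]; ring
  rw [hyb] at hfin
  simp only [hΦ] at hfin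
  linarith

end Gumbel

/-! ### Upper bound for the expected rate on one block -/

section

lemma integral_Ioi_comp_add_right (f : ℝ → ℝ) (b : ℝ) :
    ∫ t in Set.Ioi 0, f (t + b) = ∫ t in Set.Ioi b, f t := by
  rw [← integral_indicator measurableSet_Ioi, ← integral_indicator measurableSet_Ioi,
    ← integral_add_right_eq_self ((Set.Ioi b).indicator f) b]
  congr 1; ext t
  simp [Set.indicator]

lemma integrableOn_Ioi_comp_add_right {f : ℝ → ℝ} {b : ℝ} (hf : IntegrableOn f (Set.Ioi b)) :
    IntegrableOn (fun t => f (t + b)) (Set.Ioi 0) := by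
  rw [← integrable_indicator_iff measurableSet_Ioi] at hf ⊢
  refine (hf.comp_add_right b).congr (ae_of_all _ fun t => ?_)
  simp [Set.indicator]

/-- The error term in the bound for the expected rate on one resource block. -/
noncomputable def gumbelError (c : Params) (B K : ℕ) (x : ℝ) : ℝ :=
  1 / K + 2 * c.σ / x + Real.log K * Real.exp (-Real.exp (x / (2 * c.σ))) +
    8 * c.σ ^ 2 * B / x ^ 2

variable {c : Params} {B K N : ℕ} {tx : Fin B → Plane} {q : Fin B → Fin N → ℝ}

/-- The tangent of the concave logarithm at x; thereafter only the mean of the largest SINR matters.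
-/
lemma log_one_add_mul_le {q x y : ℝ} (hq : 0 ≤ q) (hx : 0 ≤ x) (hy : 0 ≤ y) :
    Real.log (1 + q * y) ≤ Real.log (1 + q * x) + q / (1 + q * x) * (y - x) := by
  have h1 : 0 < 1 + q * x := by positivity
  have h2 : 0 < 1 + q * y := by positivity
  have h3 := Real.log_le_sub_one_of_pos (div_pos h2 h1)
  rw [Real.log_div h2.ne' h1.ne'] at h3
  have h4 : (1 + q * y) / (1 + q * x) - 1 = q / (1 + q * x) * (y - x) := by
    field_simp; ring
  linarith

lemma integral_blockRate_le (hK : 0 < K) (htx : ∀ i, ‖tx i‖ ≤ c.p - c.R)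
    {z : (Fin B → Fin N → ℝ) × (Fin B → Fin N → ℝ)} (hz : z ∈ opFeasible c B N (2 * c.p) K)
    (i : Fin B) (n : Fin N) (hzx : 2 * c.σ ≤ z.2 i n) :
    ∫ ω, blockRate (K := K) c tx z.1 i n ω ∂sampleLaw c B K N ≤
      Real.log (1 + z.1 i n * z.2 i n) + z.1 i n / (1 + z.1 i n * z.2 i n) *
        (c.σ * (Real.eulerMascheroniConstant + gumbelError c B K (z.2 i n))) := by
  have : Nonempty (Fin K) := ⟨⟨0, hK⟩⟩
  obtain ⟨hx0, hxK⟩ := (mem_opFeasible.1 hz).2 i n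
  have hq := hz.1
  rw [c.loss_two_p] at hxK
  set x := z.2 i n with hx
  set b := x / 2 with hb
  have hσ := c.σ_pos
  have hb0 : 0 < b := by rw [hb]; linarith
  have hD := c.one_lt_spread
  set a : Fin B → ℝ := fun j => z.1 j n / c.spread with ha
  have ha0 : ∀ j, 0 ≤ a j := fun j => div_nonneg (hq.1 j n) (by linarith)
  set S : Fin K → Sample B K N → ℝ := fun k ω => sinr c tx (fun j => z.1 j n) i (userData n ω k)
    with hS
  have hS0 : ∀ k ω, 0 ≤ S k ω := fun k ω => sinr_nonneg (fun j => hq.1 j n) i _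
  have hSm : ∀ k, Measurable (S k) := fun k =>
    (measurable_sinr c tx _ i).comp (measurable_userData n k)
  -- Keeping only the excess over b = x/2 restricts the layer-cake integral to arguments where the
  -- Gumbel estimate applies.
  set V : Sample B K N → ℝ := fun ω => ⨆ k, max (S k ω - b) 0 with hV
  have hbdd : ∀ ω, BddAbove (Set.range fun k => max (S k ω - b) 0) := fun ω =>
    (Set.finite_range _).bddAbove
  have hV0 : ∀ ω, 0 ≤ V ω := fun ω => Real.iSup_nonneg fun k => le_max_right _ _
  have hSV : ∀ k ω, S k ω ≤ V ω + b := fun k ω => by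
    have := (le_max_left (S k ω - b) 0).trans (le_ciSup (hbdd ω) k)
    linarith
  have hVm : Measurable V := Measurable.iSup fun k => ((hSm k).sub_const b).max measurable_const
  have hVle : ∀ ω, V ω ≤ ∑ k, c.σ * ‖ω.2 (i, k, n)‖ ^ 2 := fun ω => by
    refine Real.iSup_le (fun k => ?_) (Finset.sum_nonneg fun k _ => by positivity)
    refine le_trans (max_le ?_ (by positivity)) (Finset.single_le_sum
      (f := fun k => c.σ * ‖ω.2 (i, k, n)‖ ^ 2) (fun k _ => by positivity) (Finset.mem_univ k))
    have : S k ω ≤ c.σ * ‖ω.2 (i, k, n)‖ ^ 2 := sinr_le (fun j => hq.1 j n) i _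
    linarith
  have hVint : Integrable V (sampleLaw c B K N) :=
    Integrable.mono' (integrable_finsetSum _ fun k _ =>
      (integrable_norm_sq_fading (c := c) (i, k, n)).const_mul c.σ) hVm.aestronglyMeasurable
      (ae_of_all _ fun ω => by rw [Real.norm_of_nonneg (hV0 ω)]; exact hVle ω)
  obtain ⟨hΦ, hle⟩ := integral_tail_max_le (s := Finset.univ.erase i) hσ ha0 hK c.ρ_pos
    c.ρ_lt_one.le hzx hxK
  have hV1 : ∫ ω, V ω ∂sampleLaw c B K N ≤ b + c.σ * (Real.eulerMascheroniConstant +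
      gumbelError c B K x) := by
    rw [hVint.integral_eq_integral_meas_lt (ae_of_all _ hV0)]
    calc _ ≤ ∫ t in Set.Ioi 0, (1 - (1 - c.ρ * (1 + 2 * c.σ / x) /
          growth c.σ (Finset.univ.erase i) a (t + b)) ^ K) := by
          refine integral_mono_of_nonneg (ae_of_all _ fun t => measureReal_nonneg)
            (integrableOn_Ioi_comp_add_right hΦ) ?_
          refine (ae_restrict_iff' measurableSet_Ioi).2 (ae_of_all _ fun t ht => ?_)
          have ht : 0 < t := ht
          have hset : {ω | t < V ω} = {ω | ∃ k, t + b < S k ω} := by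
            ext ω
            simp only [Set.mem_ofPred_eq]
            constructor
            · intro h
              obtain ⟨k, hk⟩ := exists_lt_of_lt_ciSup h
              refine ⟨k, ?_⟩
              rcases lt_max_iff.1 hk with h | h <;> linarith
            · rintro ⟨k, hk⟩
              have := (le_max_left (S k ω - b) 0).trans (le_ciSup (hbdd ω) k)
              simp only [hV]
              linarith
          simp only
          rw [hset, sampleLaw_exists_sinr_gt]
          have htb : 0 < t + b := by linarith
          have hg := growth_pos (σ := c.σ) (s := Finset.univ.erase i) ha0 htb.le
          have hup := userLaw_sinr_gt_le c tx htx (fun j => hq.1 j n) i htb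
          have h1 : (userLaw c B).real {y | t + b < sinr c tx (fun j => z.1 j n) i y} ≤
              c.ρ * (1 + 2 * c.σ / x) / growth c.σ (Finset.univ.erase i) a (t + b) := by
            have hρ := c.ρ_pos
            refine (ENNReal.toReal_le_of_le_ofReal (by positivity) hup).trans ?_
            have h2 : c.σ / (t + b) ≤ 2 * c.σ / x := by
              rw [div_le_div_iff₀ htb (by linarith)]
              nlinarith
            gcongr
          have h2 : c.ρ * (1 + 2 * c.σ / x) / growth c.σ (Finset.univ.erase i) a (t + b) ≤ 1 := by
            rw [div_le_one hg]
            have h3 : Real.exp ((t + b) / c.σ) ≤ _ := exp_le_growth (s := Finset.univ.erase i) ha0 htb.le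
            have h4 := Real.add_one_le_exp ((t + b) / c.σ)
            have h5 : 1 ≤ (t + b) / c.σ := by rw [one_le_div hσ, hb]; linarith
            have h6 : 2 * c.σ / x ≤ 1 := (div_le_one (by linarith)).2 hzx
            have h7 : c.ρ * (1 + 2 * c.σ / x) ≤ 1 * 2 :=
              mul_le_mul c.ρ_lt_one.le (by linarith) (by positivity) zero_le_one
            linarith
          gcongr
      _ = ∫ t in Set.Ioi b, (1 - (1 - c.ρ * (1 + 2 * c.σ / x) /
          growth c.σ (Finset.univ.erase i) a t) ^ K) :=
          integral_Ioi_comp_add_right (fun t => 1 - (1 - c.ρ * (1 + 2 * c.σ / x) /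
          growth c.σ (Finset.univ.erase i) a t) ^ K) b
      _ ≤ _ := by
          refine hle.trans ?_
          rw [gumbelError]
          have : ((Finset.univ.erase i).card : ℝ) ≤ B := by
            have := Finset.card_erase_le (s := Finset.univ) (a := i)
            rw [Finset.card_univ, Fintype.card_fin] at this
            exact_mod_cast this
          gcongr
  have hqn := hq.1 i n
  calc _ ≤ ∫ ω, (Real.log (1 + z.1 i n * x) + z.1 i n / (1 + z.1 i n * x) * (V ω + b - x))
        ∂sampleLaw c B K N := by
        refine integral_mono (integrable_blockRate hq i n) (by fun_prop) fun ω => ciSup_le fun k => ?_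
        refine (log_one_add_mul_le hqn hx0 (hS0 k ω)).trans ?_
        have := hSV k ω
        gcongr
    _ = Real.log (1 + z.1 i n * x) + z.1 i n / (1 + z.1 i n * x) *
        (∫ ω, V ω ∂sampleLaw c B K N + b - x) := by
        rw [integral_add (by fun_prop) (by fun_prop), integral_const_mul,
          integral_sub (by fun_prop) (by fun_prop), integral_add hVint (by fun_prop)]
        simp
    _ ≤ _ := by
        gcongr
        rw [hb] at hV1 ⊢
        linarith

end

/-! ### From blocks to the optimum: absorbing the error term -/

section

variable {c : Params} {B K N : ℕ} {tx : Fin B → Plane}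

lemma gumbelError_nonneg {x : ℝ} (hx : 0 ≤ x) : 0 ≤ gumbelError c B K x := by
  have := c.σ_pos
  have := Real.log_natCast_nonneg K
  unfold gumbelError
  positivity

lemma gumbelError_anti {x y : ℝ} (hx : 0 < x) (hxy : x ≤ y) :
    gumbelError c B K y ≤ gumbelError c B K x := by
  have := c.σ_pos
  have := Real.log_natCast_nonneg K
  unfold gumbelError
  gcongr

lemma div_one_add_le_log {y : ℝ} (hy : 0 ≤ y) : y / (1 + y) ≤ Real.log (1 + y) := by
  have h1 : 0 < 1 + y := by linarith
  have h2 := Real.one_sub_inv_le_log_of_pos h1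
  have h3 : y / (1 + y) = 1 - (1 + y)⁻¹ := by field_simp; ring
  linarith

/-- With w = y/(1+y), log(1+y) = -log(1 - w) = w + w²/2 + …, a series of nonnegative terms. -/
lemma sq_div_two_le_log_sub {y : ℝ} (hy : 0 ≤ y) :
    (y / (1 + y)) ^ 2 / 2 ≤ Real.log (1 + y) - y / (1 + y) := by
  have h1 : 0 < 1 + y := by linarith
  set w := y / (1 + y) with hw
  have hw0 : 0 ≤ w := by positivity
  have hw1 : 1 - w = (1 + y)⁻¹ := by rw [hw]; field_simp; ring
  have hw2 : w < 1 := by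
    have : 0 < (1 + y)⁻¹ := by positivity
    linarith
  have h2 := mul_neg_log_le_sum hw0 hw2 2
  have h3 := Real.hasSum_pow_div_log_of_abs_lt_one (x := w) (by rwa [abs_of_nonneg hw0])
  have h4 := sum_le_hasSum (Finset.range 2) (fun j _ => by positivity) h3
  rw [hw1, Real.log_inv, neg_neg] at h4
  simp [Finset.sum_range_succ] at h4
  norm_num at h4
  linarith

/-- The total fraction of the logarithmic gain that is not saturated. -/
noncomputable def saturation (z : (Fin B → Fin N → ℝ) × (Fin B → Fin N → ℝ)) : ℝ :=
  ∑ i, ∑ n, z.1 i n * z.2 i n / (1 + z.1 i n * z.2 i n)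

/-- All thresholds are at least l̄ and the error decreases in the threshold, so one error, that at
l̄, serves every block. -/
lemma expectedRate_le (hK : 0 < K) (hρK : 1 ≤ c.ρ * K) (htx : ∀ i, ‖tx i‖ ≤ c.p - c.R)
    (hl : 2 * c.σ ≤ lBar c B (2 * c.p) K)
    {z : (Fin B → Fin N → ℝ) × (Fin B → Fin N → ℝ)} (hz : z ∈ opFeasible c B N (2 * c.p) K) :
    expectedRate c N K tx z.1 ≤ opObjective z + c.σ / lBar c B (2 * c.p) K *
      (Real.eulerMascheroniConstant + gumbelError c B K (lBar c B (2 * c.p) K)) *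
        saturation z := by
  have hσ := c.σ_pos
  have hl0 : 0 < lBar c B (2 * c.p) K := by linarith
  rw [expectedRate_eq hK hz.1, opObjective, saturation, Finset.mul_sum, ← Finset.sum_add_distrib]
  refine Finset.sum_le_sum fun i _ => ?_
  rw [Finset.mul_sum, ← Finset.sum_add_distrib]
  refine Finset.sum_le_sum fun n _ => ?_
  have hlx := lBar_le_of_mem_opFeasible hρK hz i n
  refine (integral_blockRate_le hK htx hz i n (hl.trans hlx)).trans ?_
  have hy := opFeasible_nonneg hz i n
  have hx : 0 < z.2 i n := hl0.trans_le hlx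
  have hq := hz.1.1 i n
  have hu := Real.one_half_lt_eulerMascheroniConstant
  have hδ := gumbelError_nonneg (c := c) (B := B) (K := K) hl0.le
  have h1 : z.1 i n / (1 + z.1 i n * z.2 i n) * (c.σ * (Real.eulerMascheroniConstant +
      gumbelError c B K (z.2 i n))) = c.σ / z.2 i n * (Real.eulerMascheroniConstant +
      gumbelError c B K (z.2 i n)) * (z.1 i n * z.2 i n / (1 + z.1 i n * z.2 i n)) := by
    field_simp
  rw [h1]
  have h2 := gumbelError_anti (c := c) (B := B) (K := K) hl0 hlx
  have h3 := gumbelError_nonneg (c := c) (B := B) (K := K) hx.le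
  gcongr

lemma saturation_le_opObjective {z : (Fin B → Fin N → ℝ) × (Fin B → Fin N → ℝ)} {d t : ℝ}
    (hz : z ∈ opFeasible c B N d t) : saturation z ≤ opObjective z :=
  Finset.sum_le_sum fun i _ => Finset.sum_le_sum fun n _ =>
    div_one_add_le_log (opFeasible_nonneg hz i n)

lemma CLB_le_of_forall (hK : 0 < K) (hρK : 1 ≤ c.ρ * K) {M : ℝ}
    (h : ∀ z ∈ opFeasible c B N (2 * c.p) K, expectedRate c N K tx z.1 ≤ M) :
    CLB c N K tx ≤ M := by
  obtain ⟨q, hq, hqC⟩ := (isGreatest_CLB (c := c) (N := N) (tx := tx) hK).1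
  obtain ⟨x, hx⟩ := exists_mem_opFeasible (d := 2 * c.p) (by linarith [c.p_pos]) hρK hq
  exact hqC.symm.le.trans (h (q, x) hx)

lemma CLB_le_mul_OP (hK : 0 < K) (hρK : 1 ≤ c.ρ * K) (htx : ∀ i, ‖tx i‖ ≤ c.p - c.R)
    (hl : 2 * c.σ ≤ lBar c B (2 * c.p) K) :
    CLB c N K tx ≤ (1 + c.σ / lBar c B (2 * c.p) K * (Real.eulerMascheroniConstant +
      gumbelError c B K (lBar c B (2 * c.p) K))) * OP c B N (2 * c.p) K := by
  refine CLB_le_of_forall hK hρK fun z hz => (expectedRate_le hK hρK htx hl hz).trans ?_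
  have hσ := c.σ_pos
  have hl0 : 0 < lBar c B (2 * c.p) K := by linarith
  have hu := Real.one_half_lt_eulerMascheroniConstant
  have hδ := gumbelError_nonneg (c := c) (B := B) (K := K) hl0.le
  have h1 := (saturation_le_opObjective hz).trans
    (opObjective_le_OP (by linarith [c.p_pos]) hρK hz)
  have h2 := opObjective_le_OP (by linarith [c.p_pos]) hρK hz
  rw [add_mul, one_mul]
  gcongr

/-- If some product of power and threshold is not small, the concavity of the logarithm absorbs
the error term. -/
lemma mul_saturation_le {z : (Fin B → Fin N → ℝ) × (Fin B → Fin N → ℝ)} {d t u δ : ℝ}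
    (hz : z ∈ opFeasible c B N d t) (hu : 0 < u)
    (h : δ / 2 + B * N * (δ ^ 2 / (2 * u)) ≤ u / 8) {i₀ : Fin B} {n₀ : Fin N}
    (h1 : 1 ≤ z.1 i₀ n₀ * z.2 i₀ n₀) : (u + δ) * saturation z ≤ u * opObjective z := by
  set y : Fin B × Fin N → ℝ := fun r => z.1 r.1 r.2 * z.2 r.1 r.2 with hy
  have hy0 : ∀ r, 0 ≤ y r := fun r => opFeasible_nonneg hz _ _
  set w : Fin B × Fin N → ℝ := fun r => y r / (1 + y r) with hw
  set f : Fin B × Fin N → ℝ := fun r => u * (Real.log (1 + y r) - w r) - δ * w r with hf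
  have hsat : saturation z = ∑ r, w r := by
    rw [saturation, ← Fintype.sum_prod_type']
  have hobj : opObjective z = ∑ r, Real.log (1 + y r) := by
    rw [opObjective, ← Fintype.sum_prod_type']
  -- Completing the square: a single block loses at most δ²/(2u).
  have hf1 : ∀ r, 0 ≤ f r + δ ^ 2 / (2 * u) := fun r => by
    have h2 := mul_le_mul_of_nonneg_left (sq_div_two_le_log_sub (hy0 r)) hu.le
    have h3 : u * (w r ^ 2 / 2) - δ * w r + δ ^ 2 / (2 * u) = (u * w r - δ) ^ 2 / (2 * u) := by
      field_simp; ring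
    have h4 : 0 ≤ (u * w r - δ) ^ 2 / (2 * u) := by positivity
    simp only [hf]
    simp only [hw] at h3 h4 ⊢
    linarith
  -- On the distinguished block w ≥ 1/2, and hypothesis `h` says that its gain covers the losses of
  -- all B·N blocks.
  have hf2 : u / 8 - δ / 2 ≤ f (i₀, n₀) + δ ^ 2 / (2 * u) := by
    have h2 := mul_le_mul_of_nonneg_left (sq_div_two_le_log_sub (hy0 (i₀, n₀))) hu.le
    have h5 : 1 / 2 ≤ w (i₀, n₀) := by
      have : 1 ≤ y (i₀, n₀) := h1
      simp only [hw]
      rw [div_le_div_iff₀ two_pos (by linarith)]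
      linarith
    have h6 : u * (w (i₀, n₀) ^ 2 / 2) - δ * w (i₀, n₀) + δ ^ 2 / (2 * u) -
        (u / 8 - δ / 2) = (u * (w (i₀, n₀) - 1 / 2) - δ) ^ 2 / (2 * u) +
          u * (w (i₀, n₀) - 1 / 2) / 2 := by
      field_simp; ring
    have h7 : 0 ≤ (u * (w (i₀, n₀) - 1 / 2) - δ) ^ 2 / (2 * u) +
          u * (w (i₀, n₀) - 1 / 2) / 2 := by
      have : 0 ≤ w (i₀, n₀) - 1 / 2 := by linarith
      positivity
    simp only [hf]
    simp only [hw] at h6 h7 ⊢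
    linarith
  have h3 := Finset.single_le_sum (f := fun r => f r + δ ^ 2 / (2 * u)) (fun r _ => hf1 r)
    (Finset.mem_univ (i₀, n₀))
  rw [Finset.sum_add_distrib, Finset.sum_const, Finset.card_univ, Fintype.card_prod,
    Fintype.card_fin, Fintype.card_fin, nsmul_eq_mul] at h3
  push_cast at h3
  have h4 : 0 ≤ ∑ r, f r := by linarith
  simp only [hf, Finset.sum_sub_distrib, ← Finset.mul_sum] at h4
  rw [hsat, hobj]
  linarith

/-- If all products of power and threshold are small, doubling the powers improves the objective
by a constant factor. -/
lemma five_fourths_mul_opObjective_le (hρK : 1 ≤ c.ρ * K)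
    {z : (Fin B → Fin N → ℝ) × (Fin B → Fin N → ℝ)} (hz : z ∈ opFeasible c B N (2 * c.p) K)
    (hl : 0 < lBar c B (2 * c.p) K) (hB : B * Real.log 2 ≤ lBar c B (2 * c.p) K / (4 * c.σ))
    (hN : 2 * N ≤ c.Pcon * lBar c B (2 * c.p) K) (h1 : ∀ i n, z.1 i n * z.2 i n < 1) :
    5 / 4 * opObjective z ≤ OP c B N (2 * c.p) K := by
  have hσ := c.σ_pos
  have hD := c.one_lt_spread
  have hlx := lBar_le_of_mem_opFeasible hρK hz
  set l := lBar c B (2 * c.p) K with hldef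
  -- From qx < 1 and x ≥ l̄ follows q ≤ 1/l̄, so each transmitter spends at most 2N/l̄ ≤ P after
  -- doubling.
  have hq2 : (fun i n => 2 * z.1 i n) ∈ powers c B N := by
    refine ⟨fun i n => by have := hz.1.1 i n; positivity, fun i => ?_⟩
    have h2 : ∀ n ∈ Finset.univ, 2 * z.1 i n ≤ 2 / l := fun n _ => by
      rw [le_div_iff₀ hl]
      have := mul_le_mul_of_nonneg_left (hlx i n) (hz.1.1 i n)
      linarith [h1 i n]
    refine (Finset.sum_le_card_nsmul _ _ _ h2).trans ?_
    rw [Finset.card_univ, Fintype.card_fin, nsmul_eq_mul, mul_div_assoc', div_le_iff₀ hl]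
    linarith
  obtain ⟨x', hx'⟩ := exists_mem_opFeasible (d := 2 * c.p) (by linarith [c.p_pos]) hρK hq2
  refine le_trans ?_ (opObjective_le_OP (by linarith [c.p_pos]) hρK hx')
  simp only [opObjective, Finset.mul_sum]
  refine Finset.sum_le_sum fun i _ => Finset.sum_le_sum fun n _ => ?_
  obtain ⟨hx0, hx⟩ := (mem_opFeasible.1 hz).2 i n
  obtain ⟨hx0', hx1'⟩ := (mem_opFeasible.1 hx').2 i n
  rw [c.loss_two_p] at hx hx1'
  have ha : ∀ j, 0 ≤ z.1 j n / c.spread := fun j => div_nonneg (hz.1.1 j n) (by linarith)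
  -- Doubled interference lowers the threshold by at most a quarter.
  have hle : 3 / 4 * z.2 i n ≤ x' i n := by
    refine le_of_growth_le (s := Finset.univ.erase i) (a := fun j => 2 * (z.1 j n / c.spread)) hσ
      (fun j => mul_nonneg two_pos.le (ha j)) hx0' ?_
    refine (growth_two_mul_le hσ ha hx0 ?_).trans ?_
    · have h2 : ((Finset.univ.erase i).card : ℝ) ≤ B := by
        have := Finset.card_erase_le (s := Finset.univ) (a := i)
        rw [Finset.card_univ, Fintype.card_fin] at this
        exact_mod_cast this
      have h3 := Real.log_nonneg one_le_two
      calc _ ≤ B * Real.log 2 := by gcongr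
        _ ≤ _ := hB
        _ ≤ _ := by have := hlx i n; gcongr
    · rw [hx, ← hx1']
      simp only [mul_div_assoc]
      exact le_rfl
  have hy := opFeasible_nonneg hz i n
  have hq := hz.1.1 i n
  have hy1 := h1 i n
  set y := z.1 i n * z.2 i n with hydef
  have h3 := log_one_add_div_ge (D := 4) (by norm_num) hy
  -- (1 + y)(1 + y/4) ≤ 1 + 3y/2 for y ≤ 1, and `h3` contributes the extra quarter of log(1+y).
  have h4 : Real.log (1 + y) + Real.log (1 + y / 4) ≤ Real.log (1 + 2 * z.1 i n * x' i n) := by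
    rw [← Real.log_mul (by positivity) (by positivity)]
    refine Real.log_le_log (by positivity) ?_
    have h5 := mul_le_mul_of_nonneg_left hle hq
    have h6 : z.1 i n * (3 / 4 * z.2 i n) = 3 / 4 * y := by rw [hydef]; ring
    nlinarith
  linarith

lemma CLB_le_of_small_error (hK : 0 < K) (hρK : 1 ≤ c.ρ * K) (htx : ∀ i, ‖tx i‖ ≤ c.p - c.R)
    (hl : 8 * c.σ ≤ lBar c B (2 * c.p) K)
    (hB : B * Real.log 2 ≤ lBar c B (2 * c.p) K / (4 * c.σ))
    (hN : 2 * N ≤ c.Pcon * lBar c B (2 * c.p) K) {δ : ℝ}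
    (hδ : gumbelError c B K (lBar c B (2 * c.p) K) ≤ δ) (hδ1 : δ ≤ 1 / 16)
    (hBN : B * N * δ ^ 2 ≤ 1 / 32) :
    CLB c N K tx ≤ (1 + c.σ * Real.eulerMascheroniConstant / lBar c B (2 * c.p) K) *
      OP c B N (2 * c.p) K := by
  have hσ := c.σ_pos
  have hl0 : 0 < lBar c B (2 * c.p) K := by linarith
  have hu := Real.one_half_lt_eulerMascheroniConstant
  have hu' := Real.eulerMascheroniConstant_lt_two_thirds
  have hδ0 := (gumbelError_nonneg (c := c) (B := B) (K := K) hl0.le).trans hδ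
  set l := lBar c B (2 * c.p) K with hldef
  set u := Real.eulerMascheroniConstant with hudef
  refine CLB_le_of_forall hK hρK fun z hz =>
    (expectedRate_le hK hρK htx (by linarith) hz).trans ?_
  have hp : 0 < 2 * c.p := by linarith [c.p_pos]
  have hle := opObjective_le_OP hp hρK hz
  have hobj := opObjective_nonneg hz
  have hsat := saturation_le_opObjective hz
  have hsat0 : 0 ≤ saturation z := Finset.sum_nonneg fun i _ => Finset.sum_nonneg fun n _ => by
    have := opFeasible_nonneg hz i n; positivity
  have hstep : opObjective z + c.σ / l * (u + gumbelError c B K l) * saturation z ≤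
      opObjective z + c.σ / l * ((u + δ) * saturation z) := by
    rw [mul_assoc]; gcongr
  refine hstep.trans ?_
  by_cases h1 : ∀ i n, z.1 i n * z.2 i n < 1
  · have h2 := five_fourths_mul_opObjective_le hρK hz hl0 hB hN h1
    -- As u + δ ≤ 1, the rate is at most 9/8 of the objective, while OP is at least 5/4 of it.
    have h3 : c.σ / l ≤ 1 / 8 := by rw [div_le_div_iff₀ hl0 (by norm_num)]; linarith
    have h4 : c.σ / l * ((u + δ) * saturation z) ≤ 1 / 8 * (1 * opObjective z) := by
      have : u + δ ≤ 1 := by linarith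
      gcongr
    have h5 : 0 ≤ c.σ * u / l := by positivity
    have h6 : 0 ≤ OP c B N (2 * c.p) K := hobj.trans hle
    nlinarith [mul_nonneg h5 h6]
  · push Not at h1
    obtain ⟨i₀, n₀, h1⟩ := h1
    -- The smallness condition holds because δ/2 + BNδ² ≤ 1/16 < u/8, using u > 1/2.
    have h2 : (u + δ) * saturation z ≤ u * opObjective z := by
      refine mul_saturation_le hz (by linarith) ?_ h1
      have h3 : B * N * (δ ^ 2 / (2 * u)) ≤ B * N * (δ ^ 2 / 1) := by
        gcongr; linarith
      rw [div_one] at h3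
      linarith
    have h3 : 0 < c.σ / l := by positivity
    calc _ ≤ opObjective z + c.σ / l * (u * opObjective z) := by gcongr
      _ = (1 + c.σ * u / l) * opObjective z := by ring
      _ ≤ _ := by gcongr

end

/-! ### Asymptotics in the number of users -/

section

variable {c : Params} {B N : ℕ → ℕ} {tx : (K : ℕ) → Fin (B K) → Plane}

lemma tendsto_log_natCast : Tendsto (fun K : ℕ => Real.log K) atTop atTop :=
  Real.tendsto_log_atTop.comp tendsto_natCast_atTop_atTop

lemma tendsto_log_log_natCast : Tendsto (fun K : ℕ => Real.log (Real.log K)) atTop atTop :=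
  Real.tendsto_log_atTop.comp tendsto_log_natCast

lemma eventually_log_le (c : Params) : ∀ᶠ K : ℕ in atTop, Real.log K ≤ c.ρ * K := by
  have h := (Real.isLittleO_log_id_atTop.comp_tendsto
    (tendsto_natCast_atTop_atTop (R := ℝ))).bound c.ρ_pos
  filter_upwards [h] with K hK
  simp only [Function.comp, id, Real.norm_eq_abs, Nat.abs_cast] at hK
  exact (le_abs_self _).trans hK

lemma eventually_one_le (c : Params) : ∀ᶠ K : ℕ in atTop, 0 < K ∧ 1 < c.ρ * K := by
  filter_upwards [eventually_log_le c, tendsto_log_natCast.eventually_gt_atTop 1,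
    eventually_gt_atTop 0] with K h1 h2 h3
  exact ⟨h3, h2.trans_le h1⟩

lemma eventually_one_le_div_log_log (c : Params) :
    ∀ᶠ K : ℕ in atTop, 1 ≤ c.ρ * (K / Real.log (Real.log K)) := by
  filter_upwards [eventually_log_le c, tendsto_log_natCast.eventually_gt_atTop 0,
    tendsto_log_log_natCast.eventually_gt_atTop 0] with K h1 h2 h3
  rw [mul_div_assoc', one_le_div h3]
  have := Real.log_le_sub_one_of_pos h2
  linarith

/-- The hypothesis forces B = o(log K), because log log K tends to infinity. -/
lemma eventually_mul_le_log {ε : ℝ} (hε : 0 < ε)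
    (h : ∀ᶠ K : ℕ in atTop, (B K : ℝ) * Real.log (Real.log K) ≤ (1 - ε) * Real.log K) (M : ℝ) :
    ∀ᶠ K : ℕ in atTop, M * B K ≤ Real.log K := by
  filter_upwards [h, tendsto_log_natCast.eventually_gt_atTop 0,
    tendsto_log_log_natCast.eventually_ge_atTop M] with K h1 h2 h3
  have h4 := mul_le_mul_of_nonneg_right h3 (Nat.cast_nonneg (α := ℝ) (B K))
  nlinarith [mul_pos hε h2]

lemma log_eq_lBar {B K : ℕ} (hK : 0 < K) (hρK : 1 ≤ c.ρ * K) :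
    0 ≤ lBar c B (2 * c.p) K ∧ Real.log c.ρ + Real.log K = lBar c B (2 * c.p) K / c.σ +
      ((B - 1 : ℕ) : ℝ) * Real.log (1 + c.Pcon / c.spread * lBar c B (2 * c.p) K) := by
  obtain ⟨h0, hl⟩ := isLBar_iff.1 ((isLBar_iff_eq_lBar (B := B) hρK _).2 rfl)
  have ha : 0 ≤ c.Pcon / c.spread :=
    div_nonneg c.Pcon_pos.le (by linarith [c.one_lt_spread])
  refine ⟨h0, ?_⟩
  rw [growth_eq_exp (fun _ => ha) h0] at hl
  have h1 := congrArg Real.log hl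
  rw [Real.log_exp, Real.log_mul c.ρ_pos.ne' (by positivity), Finset.sum_const,
    Finset.card_range, nsmul_eq_mul] at h1
  exact h1.symm

lemma lBar_le_mul_log {B K : ℕ} (hK : 0 < K) (hρK : 1 ≤ c.ρ * K) :
    lBar c B (2 * c.p) K ≤ c.σ * Real.log K := by
  obtain ⟨h0, h1⟩ := log_eq_lBar (B := B) hK hρK
  have h2 : Real.log c.ρ ≤ 0 := Real.log_nonpos c.ρ_pos.le c.ρ_lt_one.le
  have ha : 0 ≤ c.Pcon / c.spread :=
    div_nonneg c.Pcon_pos.le (by linarith [c.one_lt_spread])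
  have h3 : 0 ≤ Real.log (1 + c.Pcon / c.spread * lBar c B (2 * c.p) K) :=
    Real.log_nonneg (by have := mul_nonneg ha h0; linarith)
  rw [← div_le_iff₀' c.σ_pos]
  have := mul_nonneg (Nat.cast_nonneg (α := ℝ) (B - 1)) h3
  linarith

/-- In the logarithmic equation for l̄, the bound l̄ ≤ σ log K limits the interference term to B(log
log K + const) ≤ (1 - ε + ε/4) log K. The constant log ρ costs another ε/4, and ε/2 remains for
l̄/σ. -/
lemma eventually_le_lBar (c : Params) {ε : ℝ} (hε : 0 < ε)
    (h : ∀ᶠ K : ℕ in atTop, (B K : ℝ) * Real.log (Real.log K) ≤ (1 - ε) * Real.log K) :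
    ∀ᶠ K : ℕ in atTop, c.σ * (ε / 2) * Real.log K ≤ lBar c (B K) (2 * c.p) K := by
  have hσ := c.σ_pos
  set a := c.Pcon / c.spread with ha
  have ha0 : 0 < a := div_pos c.Pcon_pos (by linarith [c.one_lt_spread])
  have hC : 0 ≤ Real.log (1 + a * c.σ) := Real.log_nonneg (by nlinarith)
  filter_upwards [h, tendsto_log_natCast.eventually_gt_atTop 1,
    tendsto_log_natCast.eventually_ge_atTop (-Real.log c.ρ * (4 / ε)),
    eventually_mul_le_log hε h (4 / ε * Real.log (1 + a * c.σ)),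
    eventually_one_le c] with K h1 h2 h3 h4 h5
  obtain ⟨h0, hl⟩ := log_eq_lBar (B := B K) h5.1 h5.2.le
  have hle := lBar_le_mul_log (B := B K) h5.1 h5.2.le
  set l := lBar c (B K) (2 * c.p) K with hldef
  have h6 : Real.log (1 + a * l) ≤ Real.log (1 + a * c.σ) + Real.log (Real.log K) := by
    rw [← Real.log_mul (by positivity) (by linarith)]
    refine Real.log_le_log (by positivity) ?_
    have := mul_le_mul_of_nonneg_left hle ha0.le
    nlinarith
  have h7 : ((B K - 1 : ℕ) : ℝ) ≤ B K := by exact_mod_cast Nat.sub_le _ _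
  have h8 : ((B K - 1 : ℕ) : ℝ) * Real.log (1 + a * l) ≤
      B K * (Real.log (1 + a * c.σ) + Real.log (Real.log K)) :=
    mul_le_mul h7 h6 (Real.log_nonneg (by have := mul_nonneg ha0.le h0; linarith))
      (Nat.cast_nonneg _)
  have h9 : B K * Real.log (1 + a * c.σ) ≤ ε / 4 * Real.log K := by
    have := mul_le_mul_of_nonneg_left h4 (show 0 ≤ ε / 4 by positivity)
    have e : ε / 4 * (4 / ε * Real.log (1 + a * c.σ) * B K) = B K * Real.log (1 + a * c.σ) := by
      field_simp
    linarith
  have h10 : -Real.log c.ρ ≤ ε / 4 * Real.log K := by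
    have := mul_le_mul_of_nonneg_left h3 (show 0 ≤ ε / 4 by positivity)
    have e : ε / 4 * (-Real.log c.ρ * (4 / ε)) = -Real.log c.ρ := by
      field_simp
    linarith
  have h11 : ε / 2 * Real.log K ≤ l / c.σ := by linarith
  rw [le_div_iff₀ hσ] at h11
  linarith

/-- With x of order log K, the last term is of order B/(log K)², and B ≤ log K; the doubly
exponential term is far smaller. -/
lemma eventually_gumbelError_le (c : Params) {ε : ℝ} (hε : 0 < ε)
    (h : ∀ᶠ K : ℕ in atTop, (B K : ℝ) * Real.log (Real.log K) ≤ (1 - ε) * Real.log K) :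
    ∃ C : ℝ, 0 < C ∧ ∀ᶠ K : ℕ in atTop,
      gumbelError c (B K) K (lBar c (B K) (2 * c.p) K) ≤ C / Real.log K := by
  have hσ := c.σ_pos
  set e := ε / 2 with he
  have he0 : 0 < e := by positivity
  refine ⟨1 + 2 / e + 8 / e ^ 2 + 8 / e ^ 2, by positivity, ?_⟩
  filter_upwards [eventually_le_lBar c hε h, tendsto_log_natCast.eventually_gt_atTop 0,
    eventually_mul_le_log hε h 1, eventually_one_le c] with K h1 h2 h3 h4
  set Λ := Real.log K with hΛ
  set l := lBar c (B K) (2 * c.p) K with hldef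
  have hK : (0 : ℝ) < K := by exact_mod_cast h4.1
  have hlow : 0 < c.σ * e * Λ := by positivity
  refine (gumbelError_anti hlow h1).trans ?_
  rw [gumbelError, add_div, add_div, add_div]
  refine add_le_add (add_le_add (add_le_add ?_ ?_) ?_) ?_
  · have := Real.log_le_sub_one_of_pos hK
    gcongr
    linarith
  · refine le_of_eq ?_
    field_simp
  · rw [show c.σ * e * Λ / (2 * c.σ) = e * Λ / 2 by field_simp, Real.exp_neg]
    set v := e * Λ / 2 with hv
    have hv0 : 0 < v := by positivity
    have h5 : v ≤ Real.exp v := by linarith [Real.add_one_le_exp v]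
    have h6 := Real.quadratic_le_exp_of_nonneg (Real.exp_pos v).le
    have h7 : v ^ 2 / 2 ≤ Real.exp (Real.exp v) := by
      have : v ^ 2 ≤ Real.exp v ^ 2 := by gcongr
      linarith [Real.exp_pos v]
    calc Λ * (Real.exp (Real.exp v))⁻¹ ≤ Λ * (v ^ 2 / 2)⁻¹ := by gcongr
      _ = 8 / e ^ 2 / Λ := by rw [hv]; field_simp; norm_num
  · calc 8 * c.σ ^ 2 * B K / (c.σ * e * Λ) ^ 2 ≤ 8 * c.σ ^ 2 * Λ / (c.σ * e * Λ) ^ 2 := by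
          gcongr; linarith
      _ = 8 / e ^ 2 / Λ := by field_simp

/-- All quantities in the definition of the problem are well defined for many users. -/
lemma eventually_wellDefined (c : Params) (B N : ℕ → ℕ) (tx : (K : ℕ) → Fin (B K) → Plane) :
    ∀ᶠ K : ℕ in atTop,
      (∀ q ∈ powers c (B K) (N K),
        Integrable (bestRate c (tx K) q) (sampleLaw c (B K) K (N K))) ∧
      IsGreatest (expectedRate c (N K) K (tx K) '' powers c (B K) (N K))
        (CLB c (N K) K (tx K)) ∧
      (∀ z ∈ ({(c.r₀, (K : ℝ)), (2 * c.p, (K : ℝ)),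
          (c.r₀, (K : ℝ) / Real.log (Real.log K))} : Set (ℝ × ℝ)),
        IsGreatest (opObjective '' opFeasible c (B K) (N K) z.1 z.2)
          (OP c (B K) (N K) z.1 z.2)) ∧
      (∀ l : ℝ, IsLBar c (B K) (2 * c.p) K l ↔ l = lBar c (B K) (2 * c.p) K) := by
  filter_upwards [eventually_one_le c, eventually_one_le_div_log_log c] with K h1 h2
  refine ⟨fun q hq => integrable_bestRate h1.1 hq, isGreatest_CLB h1.1, ?_,
    isLBar_iff_eq_lBar h1.2.le⟩
  have hp := c.p_pos
  rintro z (rfl | rfl | rfl)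
  · exact isGreatest_OP c.r₀_pos h1.2.le
  · exact isGreatest_OP (by linarith) h1.2.le
  · exact isGreatest_OP c.r₀_pos h2

lemma eventually_lower_bounds (c : Params) (B N : ℕ → ℕ) (hB : ∀ K, 0 < B K) (hN : ∀ K, 0 < N K)
    (tx : (K : ℕ) → Fin (B K) → Plane) (htx : ∀ K i, ‖tx K i‖ ≤ c.p - c.R) :
    ∀ᶠ K : ℕ in atTop,
      (1 - 1 / Real.log K) * OP c (B K) (N K) c.r₀ ((K : ℝ) / Real.log (Real.log K))
        ≤ CLB c (N K) K (tx K) ∧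
      0.63 * OP c (B K) (N K) c.r₀ K ≤ CLB c (N K) K (tx K) ∧
      0.63 ≤ CLB c (N K) K (tx K) / OP c (B K) (N K) c.r₀ K := by
  filter_upwards [eventually_one_le c, eventually_one_le_div_log_log c,
    tendsto_log_natCast.eventually_gt_atTop 0,
    tendsto_log_log_natCast.eventually_gt_atTop 0] with K h1 h2 h3 h4
  have hK : (0 : ℝ) < K := by exact_mod_cast h1.1
  have hρ := c.ρ_pos
  have hρ1 := c.ρ_lt_one
  have h5 : 0.63 * OP c (B K) (N K) c.r₀ K ≤ CLB c (N K) K (tx K) := by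
    have h := one_sub_exp_mul_OP_le_CLB (N := N K) h1.1 (htx K)
      (Nat.one_le_cast.2 h1.1) h1.2.le
    rw [div_self hK.ne'] at h
    refine le_trans (mul_le_mul_of_nonneg_right ?_ (OP_nonneg c.r₀_pos h1.2.le)) h
    have := Real.exp_neg_one_lt_d9
    norm_num at this ⊢
    linarith
  refine ⟨?_, h5, ?_⟩
  · have ht : 1 ≤ (K : ℝ) / Real.log (Real.log K) := by
      have : 0 < (K : ℝ) / Real.log (Real.log K) := by positivity
      nlinarith
    have h := one_sub_exp_mul_OP_le_CLB (N := N K) h1.1 (htx K) ht h2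
    -- For t = K / log log K, e^{-K/t} is exactly 1/log K.
    rwa [div_div_cancel₀ hK.ne', Real.exp_neg, Real.exp_log h3, ← one_div] at h
  · rwa [le_div_iff₀ (OP_pos (hB K) (hN K) c.r₀_pos h1.2)]

lemma lBar_isTheta_log (c : Params) {ε : ℝ} (hε : 0 < ε)
    (h : ∀ᶠ K : ℕ in atTop, (B K : ℝ) * Real.log (Real.log K) ≤ (1 - ε) * Real.log K) :
    (fun K : ℕ => lBar c (B K) (2 * c.p) K) =Θ[atTop] fun K : ℕ => Real.log K := by
  have hσ := c.σ_pos
  constructor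
  · refine IsBigO.of_bound c.σ ?_
    filter_upwards [eventually_one_le c] with K h1
    rw [Real.norm_of_nonneg (log_eq_lBar h1.1 h1.2.le).1,
      Real.norm_of_nonneg (Real.log_natCast_nonneg K)]
    exact lBar_le_mul_log h1.1 h1.2.le
  · refine IsBigO.of_bound (c.σ * (ε / 2))⁻¹ ?_
    filter_upwards [eventually_one_le c, eventually_le_lBar c hε h] with K h1 h2
    rw [Real.norm_of_nonneg (log_eq_lBar h1.1 h1.2.le).1,
      Real.norm_of_nonneg (Real.log_natCast_nonneg K), inv_mul_eq_div, le_div_iff₀' (by positivity)]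
    exact h2

lemma eventually_ratio_le (c : Params) (N : ℕ → ℕ) (hB : ∀ K, 0 < B K) (hN : ∀ K, 0 < N K)
    (htx : ∀ K i, ‖tx K i‖ ≤ c.p - c.R) {ε : ℝ} (hε : 0 < ε)
    (h : ∀ᶠ K : ℕ in atTop, (B K : ℝ) * Real.log (Real.log K) ≤ (1 - ε) * Real.log K) :
    ∃ C : ℝ, ∀ᶠ K : ℕ in atTop, CLB c (N K) K (tx K) / OP c (B K) (N K) c.r₀ K
      ≤ (2 * c.p / c.r₀) ^ (2 * c.α) + C / Real.log K := by
  have hσ := c.σ_pos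
  obtain ⟨C, hC0, hC⟩ := eventually_gumbelError_le c hε h
  have hD := c.one_lt_spread
  refine ⟨c.spread * (2 / (ε / 2)), ?_⟩
  filter_upwards [eventually_one_le c, hC, eventually_le_lBar c hε h,
    tendsto_log_natCast.eventually_gt_atTop 0, tendsto_log_natCast.eventually_ge_atTop C,
    tendsto_log_natCast.eventually_ge_atTop (2 / (ε / 2))] with K h1 h2 h3 h4 h5 h6
  have hOP := OP_pos (hB K) (hN K) c.r₀_pos h1.2
  rw [div_le_iff₀ hOP, ← c.spread_eq]
  set l := lBar c (B K) (2 * c.p) K with hl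
  have hl2 : 2 * c.σ ≤ l := by
    refine le_trans ?_ h3
    rw [div_le_iff₀ (by positivity)] at h6
    nlinarith
  have hl0 : 0 < l := by linarith
  have hu := Real.one_half_lt_eulerMascheroniConstant
  have hu' := Real.eulerMascheroniConstant_lt_two_thirds
  have hδ : gumbelError c (B K) K l ≤ 1 := h2.trans ((div_le_one h4).2 h5)
  have hδ0 := gumbelError_nonneg (c := c) (B := B K) (K := K) hl0.le
  have hOP2 := OP_nonneg (c := c) (B := B K) (N := N K) (d := 2 * c.p) (by linarith [c.p_pos]) h1.2.le
  have h7 : c.σ / l * (Real.eulerMascheroniConstant + gumbelError c (B K) K l) ≤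
      2 / (ε / 2) / Real.log K := by
    calc _ ≤ c.σ / (c.σ * (ε / 2) * Real.log K) * 2 := by
          gcongr; linarith
      _ = _ := by field_simp
  calc CLB c (N K) K (tx K) ≤ _ := CLB_le_mul_OP h1.1 h1.2.le (htx K) hl2
    _ ≤ (1 + 2 / (ε / 2) / Real.log K) * (c.spread * OP c (B K) (N K) c.r₀ K) := by
        gcongr
        exact OP_two_p_le h1.2.le
    _ = _ := by ring

lemma eventually_CLB_le (htx : ∀ K i, ‖tx K i‖ ≤ c.p - c.R) {ε : ℝ} (hε : 0 < ε)
    (h : ∀ᶠ K : ℕ in atTop, (B K : ℝ) * Real.log (Real.log K) ≤ (1 - ε) * Real.log K)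
    (hN : (fun K : ℕ => (N K : ℝ)) =o[atTop] fun K : ℕ => Real.log K) :
    ∀ᶠ K : ℕ in atTop, CLB c (N K) K (tx K) ≤
      (1 + c.σ * Real.eulerMascheroniConstant / lBar c (B K) (2 * c.p) K) *
        OP c (B K) (N K) (2 * c.p) K := by
  have hσ := c.σ_pos
  have hP := c.Pcon_pos
  have hlog2 := Real.log_pos one_lt_two
  obtain ⟨C, hC0, hC⟩ := eventually_gumbelError_le c hε h
  have hNτ : ∀ τ : ℝ, 0 < τ → ∀ᶠ K : ℕ in atTop, (N K : ℝ) ≤ τ * Real.log K := fun τ hτ => by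
    filter_upwards [hN.bound hτ] with K hK
    rwa [Real.norm_of_nonneg (Nat.cast_nonneg _),
      Real.norm_of_nonneg (Real.log_natCast_nonneg K)] at hK
  filter_upwards [eventually_one_le c, hC, eventually_le_lBar c hε h,
    tendsto_log_natCast.eventually_gt_atTop 0, tendsto_log_natCast.eventually_ge_atTop (16 * C),
    tendsto_log_natCast.eventually_ge_atTop (8 / (ε / 2)),
    eventually_mul_le_log hε h (4 * Real.log 2 / (ε / 2)), eventually_mul_le_log hε h 1,
    hNτ (c.Pcon * (c.σ * (ε / 2)) / 2) (by positivity), hNτ (1 / (32 * C ^ 2)) (by positivity)]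
    with K h1 h2 h3 h4 h5 h6 h7 h8 h9 h10
  refine CLB_le_of_small_error h1.1 h1.2.le (htx K) ?_ ?_ ?_ h2 ?_ ?_
  · refine le_trans ?_ h3
    rw [div_le_iff₀ (by positivity)] at h6
    nlinarith
  · rw [le_div_iff₀ (by positivity)]
    refine le_trans ?_ h3
    rw [div_mul_eq_mul_div, div_le_iff₀ (by positivity)] at h7
    nlinarith
  · have := mul_le_mul_of_nonneg_left h3 hP.le
    nlinarith
  · rw [div_le_div_iff₀ h4 (by norm_num)]
    linarith
  -- B ≤ log K and N ≤ log K/(32C²) cancel against δ² = C²/(log K)².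
  · rw [one_mul] at h8
    calc (B K : ℝ) * N K * (C / Real.log K) ^ 2 ≤
        Real.log K * (1 / (32 * C ^ 2) * Real.log K) * (C / Real.log K) ^ 2 := by gcongr
      _ = 1 / 32 := by field_simp

end

end DenseNet

theorem corollary1 (c : DenseNet.Params) (B N : ℕ → ℕ)
    (hB : ∀ K, 0 < B K) (hN : ∀ K, 0 < N K)
    (tx : (K : ℕ) → Fin (B K) → DenseNet.Plane)
    (htx : ∀ K i, ‖tx K i‖ ≤ c.p - c.R) :
    -- for large `K` all quantities are well defined: the expectations exist, the maxima are
    -- attained, and the defining equation of `l̄(2p, K)` has exactly one solution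
    (∀ᶠ K : ℕ in atTop,
      (∀ q ∈ DenseNet.powers c (B K) (N K),
        Integrable (DenseNet.bestRate c (tx K) q) (DenseNet.sampleLaw c (B K) K (N K))) ∧
      IsGreatest (DenseNet.expectedRate c (N K) K (tx K) '' DenseNet.powers c (B K) (N K))
        (DenseNet.CLB c (N K) K (tx K)) ∧
      (∀ z ∈ ({(c.r₀, (K : ℝ)), (2 * c.p, (K : ℝ)),
          (c.r₀, (K : ℝ) / Real.log (Real.log K))} : Set (ℝ × ℝ)),
        IsGreatest (DenseNet.opObjective '' DenseNet.opFeasible c (B K) (N K) z.1 z.2)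
          (DenseNet.OP c (B K) (N K) z.1 z.2)) ∧
      (∀ l : ℝ, DenseNet.IsLBar c (B K) (2 * c.p) K l ↔
        l = DenseNet.lBar c (B K) (2 * c.p) K)) ∧
    -- the lower bounds, whatever the growth of `B` and `N`
    (∀ᶠ K : ℕ in atTop,
      (1 - 1 / Real.log K) *
          DenseNet.OP c (B K) (N K) c.r₀ ((K : ℝ) / Real.log (Real.log K))
        ≤ DenseNet.CLB c (N K) K (tx K) ∧
      0.63 * DenseNet.OP c (B K) (N K) c.r₀ K ≤ DenseNet.CLB c (N K) K (tx K) ∧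
      0.63 ≤ DenseNet.CLB c (N K) K (tx K) / DenseNet.OP c (B K) (N K) c.r₀ K) ∧
    -- the upper bounds, for instance for bounded `B` and `N`
    ((∃ ε : ℝ, 0 < ε ∧
        ∀ᶠ K : ℕ in atTop, (B K : ℝ) * Real.log (Real.log K) ≤ (1 - ε) * Real.log K) →
      ((fun K : ℕ => DenseNet.lBar c (B K) (2 * c.p) K) =Θ[atTop]
        fun K : ℕ => Real.log K) ∧
      (∃ C : ℝ, ∀ᶠ K : ℕ in atTop,
        DenseNet.CLB c (N K) K (tx K) / DenseNet.OP c (B K) (N K) c.r₀ K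
          ≤ (2 * c.p / c.r₀) ^ (2 * c.α) + C / Real.log K) ∧
      (((fun K : ℕ => (N K : ℝ)) =o[atTop] fun K : ℕ => Real.log K) →
        ∀ᶠ K : ℕ in atTop,
          DenseNet.CLB c (N K) K (tx K)
            ≤ (1 + c.σ * Real.eulerMascheroniConstant / DenseNet.lBar c (B K) (2 * c.p) K) *
              DenseNet.OP c (B K) (N K) (2 * c.p) K ∧
          DenseNet.CLB c (N K) K (tx K)
            ≤ (2 * c.p / c.r₀) ^ (2 * c.α) *
              (1 + c.σ * Real.eulerMascheroniConstant / DenseNet.lBar c (B K) (2 * c.p) K) *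
              DenseNet.OP c (B K) (N K) c.r₀ K)) := by
  refine ⟨DenseNet.eventually_wellDefined c B N tx,
    DenseNet.eventually_lower_bounds c B N hB hN tx htx, ?_⟩
  rintro ⟨ε, hε, h⟩
  refine ⟨DenseNet.lBar_isTheta_log c hε h,
    DenseNet.eventually_ratio_le c N hB hN htx hε h, fun hNo => ?_⟩
  filter_upwards [DenseNet.eventually_CLB_le htx hε h hNo, DenseNet.eventually_one_le c] with K h1 h2
  refine ⟨h1, h1.trans ?_⟩
  have hu := Real.one_half_lt_eulerMascheroniConstant
  have hl := (DenseNet.log_eq_lBar (B := B K) h2.1 h2.2.le).1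
  have hσ := c.σ_pos
  rw [← c.spread_eq, mul_comm c.spread, mul_assoc]
  refine mul_le_mul_of_nonneg_left (DenseNet.OP_two_p_le h2.2.le) ?_
  positivity
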